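/- Let $\mathcal G_d=(\mathcal V,\mathcal E)$ be an undirected graph with countably infinite vertex and edge sets which is connected, locally finite (every vertex has finitely many incident edges) and simple (no loops or multiple edges), and let each edge $e\in\mathcal E$ be given a length $|e|\in(0,\infty)$. Let $\mathcal G$ be the resulting metric graph: each edge $e$ is identified with the interval $[0,|e|]$ (after choosing a direction), and endpoints of edges corresponding to the same vertex are glued together; $\mathcal G$ carries the natural topology and $\mathrm{vol}$ denotes its Lebesgue measure. For $f:\mathcal G\to\mathbb C$ let $f_e$ be the restriction of $f$ to $e$, and put $\|f\|_{L^2(\mathcal G)}^2=\sum_{e}\|f_e\|_{L^2(e)}^2$ and $\|f'\|_{L^2(\mathcal G)}^2=\sum_{e}\|f_e'\|_{L^2(e)}^2$. Let $H^1(\mathcal G)$ be the space of continuous functions $f:\mathcal G\to\mathbb C$ with $f_e\in H^1(e)$ for all $e\in\mathcal E$ (that is, $f_e$ is absolutely continuous with $f_e'\in L^2(e)$), $\|f\|_{L^2(\mathcal G)}<\infty$ and $\|f'\|_{L^2(\mathcal G)}<\infty$, with the norm $\|f\|_{H^1(\mathcal G)}^2=\|f\|_{L^2(\mathcal G)}^2+\|f'\|_{L^2(\mathcal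 G)}^2$. Let $D$ be the space of continuous functions $f:\mathcal G\to\mathbb C$ that are non-zero only on finitely many edges, satisfy $f_e\in H^2(e)$ (that is, $f_e,f_e'\in H^1(e)$) for all $e\in\mathcal E$, and satisfy the Kirchhoff condition $\sum_{e\ni v}f_e'(v)=0$ at every vertex $v$, where $f_e'(v)$ is the derivative of $f_e$ at $v$ in the direction pointing from $v$ into $e$. Let $H^1_0(\mathcal G)$ be the closure of $D$ in $H^1(\mathcal G)$ with respect to $\|\cdot\|_{H^1(\mathcal G)}$. A topological end of $\mathcal G$ is an equivalence class of sequences $(U_n)_{n\ge0}$ of non-empty open connected subsets of $\mathcal G$ with compact boundaries such that $U_{n+1}\subseteq U_n$ for all $n$ and $\bigcap_n\overline{U_n}=\emptyset$, where $(U_n)$ and $(U_n')$ are equivalent if for every $n$ there are $j,k$ with $U'_j\subseteq U_n$ and $U_k\subseteq U'_n$. A topological end has finite volume if it is represented by some sequence $(U_n)$ such that $\mathrm{vol}(U_n)<\infty$ for some $n$; otherwise it has infinite volume. Then $H^1(\mathcal G)=H^1_0(\mathcal G)$ if and only if all topological ends of $\mathcal G$ have infinite volume. -/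

import Mathlib

open Set Filter Topology MeasureTheory
open scoped ENNReal

noncomputable section

/-- A metric graph over a vertex set `V`: a connected, locally finite, simple graph together with
a length in `(0, ∞)` for each edge and a choice of a direction for each edge (the direction only
serves to identify the edge with the interval `[0, length e]`). -/
structure MetricGraph (V : Type*) where
  /-- the underlying combinatorial graph -/
  graph : SimpleGraph V
  connected : graph.Connected
  /-- every vertex has finitely many incident edges -/
  locallyFinite : ∀ v : V, {e : graph.edgeSet | v ∈ (e : Sym2 V)}.Finite
  /-- the initial vertex of an edge -/
  src : graph.edgeSet → V
  /-- the terminal vertex of an edge -/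
  tgt : graph.edgeSet → V
  mk_src_tgt : ∀ e : graph.edgeSet, s(src e, tgt e) = (e : Sym2 V)
  /-- the edge lengths -/
  length : graph.edgeSet → ℝ
  length_pos : ∀ e, 0 < length e

namespace MetricGraph

variable {V : Type*} (Γ : MetricGraph V)

/-- The edges of a metric graph. -/
abbrev Edge : Type _ := Γ.graph.edgeSet

/-- The points of a metric graph: the vertices, and the interior points of the edges. This is the
disjoint union of the intervals `[0, length e]` in which endpoints belonging to the same vertex
are identified. -/
inductive Point : Type _
  | vertex (v : V) : Point
  | inner (e : Γ.Edge) (t : ℝ) (ht : t ∈ Ioo 0 (Γ.length e)) : Point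

/-- The parametrization `[0, length e] → Γ` of the edge `e`, from its initial to its terminal
vertex; it is extended to all of `ℝ` by being constant outside `[0, length e]`. -/
def param (e : Γ.Edge) (t : ℝ) : Γ.Point :=
  if h₀ : t ≤ 0 then Point.vertex (Γ.src e)
  else if h₁ : Γ.length e ≤ t then Point.vertex (Γ.tgt e)
  else Point.inner e t ⟨not_le.mp h₀, not_le.mp h₁⟩

/-- The natural topology: the quotient topology of the disjoint union of the intervals
`[0, length e]`, that is, `U` is open iff its preimage in `[0, length e]` is open for all `e`. -/
instance : TopologicalSpace Γ.Point :=
  ⨆ e : Γ.Edge, TopologicalSpace.coinduced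
    (fun t : Icc (0 : ℝ) (Γ.length e) => Γ.param e t) inferInstance

/-- The Lebesgue measure of a (measurable) set `A ⊆ Γ`. -/
def vol (A : Set Γ.Point) : ℝ≥0∞ :=
  ∑' e : Γ.Edge, volume {t : ℝ | t ∈ Icc 0 (Γ.length e) ∧ Γ.param e t ∈ A}

/-! ### Topological ends -/

/-- Decreasing sequences of non-empty open connected sets with compact boundaries whose closures
have empty intersection. -/
structure EndSeq where
  /-- the `n`-th set of the sequence -/
  set : ℕ → Set Γ.Point
  isOpen : ∀ n, IsOpen (set n)
  /-- connected, and in particular non-empty -/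
  isConnected : ∀ n, IsConnected (set n)
  isCompact_frontier : ∀ n, IsCompact (frontier (set n))
  subset : ∀ n, set (n + 1) ⊆ set n
  iInter_closure : ⋂ n, closure (set n) = ∅

/-- Two sequences are equivalent if each set of either contains some set of the other. -/
instance EndSeq.setoid : Setoid Γ.EndSeq where
  r U U' := ∀ n, (∃ j, U'.set j ⊆ U.set n) ∧ (∃ k, U.set k ⊆ U'.set n)
  iseqv :=
    { refl := fun _ n => ⟨⟨n, Subset.rfl⟩, ⟨n, Subset.rfl⟩⟩
      symm := fun h n => ⟨(h n).2, (h n).1⟩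
      trans := fun {U U' U''} h h' n => by
        obtain ⟨j, hj⟩ := (h n).1
        obtain ⟨k, hk⟩ := (h' j).1
        obtain ⟨j', hj'⟩ := (h' n).2
        obtain ⟨k', hk'⟩ := (h j').2
        exact ⟨⟨k, hk.trans hj⟩, ⟨k', hk'.trans hj'⟩⟩ }

/-- The topological ends of `Γ`. -/
def TopEnd : Type _ := Quotient (EndSeq.setoid Γ)

variable {Γ} in
/-- The end `γ` has finite volume: for some sequence `U` representing `γ`, some `U n` has finite
volume. -/
def TopEnd.HasFiniteVolume (γ : Γ.TopEnd) : Prop :=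
  ∃ U : Γ.EndSeq, Quotient.mk (EndSeq.setoid Γ) U = γ ∧ ∃ n, Γ.vol (U.set n) < ∞

variable {Γ} in
/-- The end `γ` has infinite volume if it does not have finite volume. -/
def TopEnd.HasInfiniteVolume (γ : Γ.TopEnd) : Prop := ¬ γ.HasFiniteVolume

/-! ### Sobolev spaces on an interval -/

/-- The Sobolev space `H¹(0, L)`: the absolutely continuous functions on `[0, L]` whose
(almost everywhere defined) derivative is square integrable. -/
def IntervalH1 (L : ℝ) (f : ℝ → ℂ) : Prop :=
  AbsolutelyContinuousOnInterval f 0 L ∧ MemLp (deriv f) 2 (volume.restrict (Ioo 0 L))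

/-- The Sobolev space `H²(0, L)`: the functions in `H¹(0, L)` whose derivative is in `H¹(0, L)`
(that is, it agrees almost everywhere with a function as in `IntervalH1`). -/
def IntervalH2 (L : ℝ) (f : ℝ → ℂ) : Prop :=
  IntervalH1 L f ∧ ∃ g : ℝ → ℂ, IntervalH1 L g ∧ deriv f =ᵐ[volume.restrict (Ioo 0 L)] g

/-! ### Function spaces on the metric graph -/

/-- The restriction `f_e` of `f` to the edge `e`, as a function of the parameter. -/
def onEdge (f : Γ.Point → ℂ) (e : Γ.Edge) (t : ℝ) : ℂ := f (Γ.param e t)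

/-- `‖f‖²` in `L²(Γ)`, the sum over all edges `e` of the squared norm of `f_e` in `L²(e)`. -/
def l2NormSq (f : Γ.Point → ℂ) : ℝ≥0∞ :=
  ∑' e : Γ.Edge, ∫⁻ t in Ioo 0 (Γ.length e), ‖Γ.onEdge f e t‖ₑ ^ 2

/-- `‖f'‖²` in `L²(Γ)`, the sum over all edges `e` of the squared norm of `f_e'` in `L²(e)`. -/
def energy (f : Γ.Point → ℂ) : ℝ≥0∞ :=
  ∑' e : Γ.Edge, ∫⁻ t in Ioo 0 (Γ.length e), ‖deriv (Γ.onEdge f e) t‖ₑ ^ 2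

/-- The norm of `H¹(Γ)`. -/
def h1Norm (f : Γ.Point → ℂ) : ℝ≥0∞ := (Γ.l2NormSq f + Γ.energy f) ^ (1 / 2 : ℝ)

/-- The Sobolev space `H¹(Γ)`: the continuous functions `f` in `L²(Γ)` such that `f_e ∈ H¹(e)` for
all edges `e` and `‖f'‖² < ∞`. -/
def H1 : Set (Γ.Point → ℂ) :=
  {f | Continuous f ∧ Γ.l2NormSq f < ∞ ∧ (∀ e, IntervalH1 (Γ.length e) (Γ.onEdge f e)) ∧
    Γ.energy f < ∞}

open Classical in
/-- The derivative `f_e'(v)` of `f` along the edge `e` at its endpoint `v`, in the direction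
pointing from `v` into the edge. -/
def outwardDeriv (f : Γ.Point → ℂ) (e : Γ.Edge) (v : V) : ℂ :=
  if Γ.src e = v then derivWithin (Γ.onEdge f e) (Icc 0 (Γ.length e)) 0
  else -derivWithin (Γ.onEdge f e) (Icc 0 (Γ.length e)) (Γ.length e)

/-- The domain of the pre-minimal Kirchhoff Laplacian: the functions `f` with `f_e ∈ H²(e)` for
every edge `e` that are non-zero only on finitely many edges and satisfy the Kirchhoff conditions
(`f` is continuous, and the outward derivatives sum to zero at each vertex). -/
def domPreminimal : Set (Γ.Point → ℂ) :=
  {f | (∀ e, IntervalH2 (Γ.length e) (Γ.onEdge f e)) ∧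
    {e : Γ.Edge | ∃ t ∈ Icc 0 (Γ.length e), Γ.onEdge f e t ≠ 0}.Finite ∧
    Continuous f ∧ ∀ v : V, ∑ e ∈ (Γ.locallyFinite v).toFinset, Γ.outwardDeriv f e v = 0}

/-- The space `H¹₀(Γ)`: the closure in `H¹(Γ)` of the domain of the pre-minimal Kirchhoff
Laplacian, with respect to the norm of `H¹(Γ)`. -/
def H10 : Set (Γ.Point → ℂ) :=
  {f | f ∈ Γ.H1 ∧ ∀ ε : ℝ≥0∞, 0 < ε → ∃ g ∈ Γ.domPreminimal, Γ.h1Norm (f - g) < ε}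

end MetricGraph

end

/-!
The square of `‖f‖` oscillates along an edge by at most the share of that edge in the squared
`H¹` norm of `f`.

If an open set `U` of an end has finite volume, take the edgewise affine function equal to `1` at
the vertices in `U` and to `0` at the others. It differs from the indicator function of `U` only on
the finitely many edges meeting the compact boundary of `U`, so it is in `H¹`. As the `H¹` norm
controls the values at all vertices uniformly and `U` contains infinitely many vertices, it is not a
limit of functions that vanish off finitely many edges.

Conversely, if `f` in `H¹` does not vanish at infinity, then vertices at which `‖f‖` is bounded
below accumulate at an end. The part of the norm on a small neighbourhood of the end is small, so
that `‖f‖` is bounded below on all of it, and the end has finite volume by Markov's inequality. Thus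
if all ends have infinite volume, `f` vanishes at infinity. Subtracting from `f` its composition
with the retraction onto a small ball, which is small in `H¹`, leaves a function supported on
finitely many edges. Smoothing it edgewise, with vanishing derivatives at the vertices, gives an
element of the domain.
-/

noncomputable section

namespace MetricGraph

/-! ### Connected infinite graphs -/

section Graph

variable {V : Type*} {G : SimpleGraph V}

lemma le_add_sum_edges_of_walk {a : V → ℝ≥0∞} {w : Sym2 V → ℝ≥0∞}
    (haw : ∀ {x y}, G.Adj x y → a x ≤ a y + w s(x, y)) {u v : V} (p : G.Walk u v) :
    a u ≤ a v + (p.edges.map w).sum := by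
  induction p with
  | nil => simp
  | @cons u x v h p ih =>
    calc a u ≤ a x + w s(u, x) := haw h
      _ ≤ (a v + (p.edges.map w).sum) + w s(u, x) := by gcongr
      _ = a v + ((SimpleGraph.Walk.cons h p).edges.map w).sum := by
        rw [SimpleGraph.Walk.edges_cons, List.map_cons, List.sum_cons, add_assoc, add_comm (w _)]

lemma le_add_tsum_of_reachable {a : V → ℝ≥0∞} {w : G.edgeSet → ℝ≥0∞}
    (haw : ∀ {x y} (h : G.Adj x y), a x ≤ a y + w ⟨s(x, y), h⟩) {u v : V}
    (huv : G.Reachable u v) : a u ≤ a v + ∑' e, w e := by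
  classical
  obtain ⟨p, hp⟩ := huv.exists_isPath
  let w' : Sym2 V → ℝ≥0∞ := Function.extend Subtype.val w 0
  have hw' (e : G.edgeSet) : w' e = w e := Subtype.val_injective.extend_apply w 0 e
  calc a u ≤ a v + (p.edges.map w').sum :=
        le_add_sum_edges_of_walk (fun {x y} h => (hw' ⟨s(x, y), h⟩).symm ▸ haw h) p
    _ = a v + ∑ e ∈ p.edges.toFinset, w' e := by rw [List.sum_toFinset w' hp.isTrail.edges_nodup]
    _ ≤ a v + ∑' e, w' e := by gcongr; exact ENNReal.sum_le_tsum _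
    _ = a v + ∑' e, w e := by rw [tsum_extend_zero Subtype.val_injective]

lemma exists_exhaustion (hG : G.Connected) (hfin : ∀ v, (G.neighborSet v).Finite) :
    ∃ K : ℕ → Finset V, Monotone K ∧ ∀ v, ∃ n, v ∈ K n := by
  classical
  obtain ⟨x₀⟩ := hG.nonempty
  let K : ℕ → Finset V := Nat.rec {x₀} fun _ A => A ∪ A.biUnion fun v => (hfin v).toFinset
  refine ⟨K, monotone_nat_of_le_succ fun n => Finset.subset_union_left, fun v => ?_⟩
  obtain ⟨p⟩ := hG.preconnected v x₀
  induction p with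
  | nil => exact ⟨0, Finset.mem_singleton_self _⟩
  | @cons u x _ h _ ih =>
    obtain ⟨n, hn⟩ := ih
    refine ⟨n + 1, Finset.mem_union_right _ (Finset.mem_biUnion.2 ⟨x, hn, ?_⟩)⟩
    exact (hfin x).mem_toFinset.2 h.symm

lemma connected_induce_componentCompl {K : Set V} (C : G.ComponentCompl K) :
    (G.induce (C : Set V)).Connected := by
  let φ : C.toSimpleGraph →g G.induce (C : Set V) :=
    { toFun := fun v => ⟨v.1.1, v.1.2, v.2⟩, map_rel' := fun h => h }
  refine C.connected_toSimpleGraph.map φ fun ⟨v, hv⟩ => ?_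
  exact ⟨⟨⟨v, hv.1⟩, hv.2⟩, rfl⟩

lemma exists_componentCompl_mem_ultrafilter (hG : G.Preconnected)
    (hfin : ∀ v, (G.neighborSet v).Finite) {𝒰 : Ultrafilter V}
    (h𝒰 : (𝒰 : Filter V) ≤ cofinite) (K : Finset V) :
    ∃ C : G.ComponentCompl K, (C : Set V) ∈ 𝒰 := by
  have : Fact G.Preconnected := ⟨hG⟩
  have : G.LocallyFinite := fun v => (hfin v).fintype
  have hK : ∀ᶠ v in (𝒰 : Filter V), ∃ C : G.ComponentCompl K, v ∈ C := by
    filter_upwards [h𝒰 K.finite_toSet.compl_mem_cofinite] with v hv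
    exact ⟨_, G.componentComplMk_mem hv⟩
  exact Ultrafilter.eventually_exists_iff.1 hK

lemma exists_antitone_connected_of_infinite (hG : G.Connected)
    (hfin : ∀ v, (G.neighborSet v).Finite) {S : Set V} (hS : S.Infinite) :
    ∃ C : ℕ → Set V, Antitone C ∧ ⋂ n, C n = ∅ ∧ ∀ n, (G.induce (C n)).Connected ∧
      {v | v ∉ C n ∧ ∃ u ∈ C n, G.Adj u v}.Finite ∧ (S ∩ C n).Nonempty := by
  obtain ⟨K, hKmono, hKcover⟩ := exists_exhaustion hG hfin
  have := hS.cofinite_inf_principal_neBot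
  obtain ⟨𝒰, h𝒰⟩ := Ultrafilter.exists_le (cofinite ⊓ 𝓟 S)
  choose C hC using exists_componentCompl_mem_ultrafilter hG.preconnected hfin
    (h𝒰.trans inf_le_left)
  have hS𝒰 : S ∈ 𝒰 := h𝒰.trans inf_le_right (mem_principal_self S)
  refine ⟨fun n => C (K n), fun m n hmn => ?_, ?_, fun n =>
    ⟨connected_induce_componentCompl _, (K n).finite_toSet.subset ?_,
      𝒰.nonempty_of_mem (inter_mem hS𝒰 (hC _))⟩⟩
  · have hle : (K m : Set V) ⊆ K n := Finset.coe_subset.2 (hKmono hmn)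
    refine ((C (K n)).hom_eq_iff_le hle _).1 (((C (K n)).hom_eq_iff_not_disjoint hle _).2 ?_)
    exact not_disjoint_iff_nonempty_inter.2 (𝒰.nonempty_of_mem (inter_mem (hC _) (hC _)))
  · refine eq_empty_of_forall_notMem fun v hv => ?_
    obtain ⟨n, hn⟩ := hKcover v
    exact (C (K n)).notMem_of_mem (mem_iInter.1 hv n) hn
  · rintro v ⟨hv, u, hu, huv⟩
    by_contra hvK
    exact hv ((C (K n)).mem_of_adj u v hu hvK huv)

end Graph

/-! ### Sobolev functions on an interval -/

section AbsolutelyContinuous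

lemma absolutelyContinuousOnInterval_congr {X : Type*} [PseudoMetricSpace X] {f g : ℝ → X}
    {a b : ℝ} (hf : AbsolutelyContinuousOnInterval f a b) (h : EqOn f g (uIcc a b)) :
    AbsolutelyContinuousOnInterval g a b := by
  refine Tendsto.congr' ?_ hf
  filter_upwards [mem_inf_of_right (mem_principal_self _)] with E hE
  exact Finset.sum_congr rfl fun i hi => by rw [h (hE.1 i hi).1, h (hE.1 i hi).2]

lemma absolutelyContinuousOnInterval_lipschitz_comp {X Y : Type*} [PseudoMetricSpace X]
    [PseudoMetricSpace Y] {φ : X → Y} {K : NNReal} (hφ : LipschitzWith K φ) {f : ℝ → X} {a b : ℝ}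
    (hf : AbsolutelyContinuousOnInterval f a b) :
    AbsolutelyContinuousOnInterval (φ ∘ f) a b := by
  refine squeeze_zero (fun t => Finset.sum_nonneg fun i _ => dist_nonneg) (fun t => ?_)
    (by simpa using Tendsto.const_mul (K : ℝ) hf)
  rw [Finset.mul_sum]
  exact Finset.sum_le_sum fun i _ => hφ.dist_le_mul _ _

lemma norm_deriv_lipschitz_comp_le {E F : Type*} [NormedAddCommGroup E] [NormedSpace ℝ E]
    [NormedAddCommGroup F] [NormedSpace ℝ F] {φ : E → F} {K : NNReal} (hφ : LipschitzWith K φ)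
    {f : ℝ → E} {t : ℝ} (hf : DifferentiableAt ℝ f t) :
    ‖deriv (φ ∘ f) t‖ ≤ K * ‖deriv f t‖ := by
  have hlim : Tendsto (fun r : ℝ => K * r) (𝓝[>] ‖deriv f t‖) (𝓝 (K * ‖deriv f t‖)) :=
    (tendsto_id.const_mul _).mono_left nhdsWithin_le_nhds
  refine ge_of_tendsto hlim ?_
  filter_upwards [self_mem_nhdsWithin] with r (hr : ‖deriv f t‖ < r)
  have hr0 : 0 ≤ r := (norm_nonneg _).trans hr.le
  have hslope := hf.hasDerivAt.hasDerivWithinAt.limsup_norm_slope_le (s := univ) hr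
  rw [nhdsWithin_univ] at hslope
  refine norm_deriv_le_of_lip' (by positivity) ?_
  filter_upwards [hslope] with x hx
  calc ‖φ (f x) - φ (f t)‖ ≤ K * ‖f x - f t‖ := hφ.norm_sub_le _ _
    _ ≤ K * (r * ‖x - t‖) := by
      gcongr
      rcases eq_or_ne x t with rfl | hxt
      · simp
      · rw [inv_mul_eq_div, div_lt_iff₀ (norm_pos_iff.2 (sub_ne_zero.2 hxt))] at hx
        exact hx.le
    _ = K * r * ‖x - t‖ := (mul_assoc _ _ _).symm

lemma enorm_deriv_lipschitz_comp_le {E F : Type*} [NormedAddCommGroup E] [NormedSpace ℝ E]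
    [NormedAddCommGroup F] [NormedSpace ℝ F] {φ : E → F} {K : NNReal} (hφ : LipschitzWith K φ)
    {f : ℝ → E} {t : ℝ} (hf : DifferentiableAt ℝ f t) :
    ‖deriv (φ ∘ f) t‖ₑ ≤ K * ‖deriv f t‖ₑ := by
  rw [← ofReal_norm, ← ofReal_norm, ← ENNReal.ofReal_coe_nnreal, ← ENNReal.ofReal_mul K.coe_nonneg]
  exact ENNReal.ofReal_le_ofReal (norm_deriv_lipschitz_comp_le hφ hf)

variable {E : Type*} [NormedAddCommGroup E] [NormedSpace ℝ E] [FiniteDimensional ℝ E] {L : ℝ}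
  {f g : ℝ → E}

lemma ae_differentiableAt_of_absolutelyContinuousOnInterval
    (hf : AbsolutelyContinuousOnInterval f 0 L) :
    ∀ᵐ t ∂volume.restrict (Ioo 0 L), DifferentiableAt ℝ f t := by
  rw [ae_restrict_iff' measurableSet_Ioo]
  filter_upwards [hf.boundedVariationOn.ae_differentiableAt_of_mem_uIcc] with t ht h
  exact ht (Icc_subset_uIcc (Ioo_subset_Icc_self h))

lemma enorm_sub_le_lintegral_enorm_deriv_of_real {f : ℝ → ℝ}
    (hf : AbsolutelyContinuousOnInterval f 0 L) {s t : ℝ} (hs : s ∈ Icc 0 L) (ht : t ∈ Icc 0 L) :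
    ‖f t - f s‖ₑ ≤ ∫⁻ x in Ioo 0 L, ‖deriv f x‖ₑ := by
  wlog hst : s ≤ t generalizing s t
  · rw [← edist_eq_enorm_sub, edist_comm, edist_eq_enorm_sub]
    exact this ht hs (le_of_not_ge hst)
  have hsub : uIcc s t ⊆ uIcc 0 L :=
    uIcc_subset_uIcc (Icc_subset_uIcc hs) (Icc_subset_uIcc ht)
  rw [← (hf.mono hsub).integral_deriv_eq_sub, intervalIntegral.integral_of_le hst]
  refine (enorm_integral_le_lintegral_enorm _).trans ?_
  rw [← restrict_Ioo_eq_restrict_Ioc]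
  exact lintegral_mono_set (Ioo_subset_Ioo hs.1 ht.2)

lemma enorm_sub_le_lintegral_enorm_deriv (hf : AbsolutelyContinuousOnInterval f 0 L) {s t : ℝ}
    (hs : s ∈ Icc 0 L) (ht : t ∈ Icc 0 L) :
    ‖f t - f s‖ₑ ≤ ∫⁻ x in Ioo 0 L, ‖deriv f x‖ₑ := by
  have hφ : LipschitzWith 1 fun z : E => ‖z - f s‖ :=
    LipschitzWith.of_dist_le_mul fun z w => by
      simpa [Real.dist_eq, dist_eq_norm] using abs_norm_sub_norm_le (z - f s) (w - f s)
  calc ‖f t - f s‖ₑ = ‖‖f t - f s‖ - ‖f s - f s‖‖ₑ := by simp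
    _ ≤ ∫⁻ x in Ioo 0 L, ‖deriv ((fun z : E => ‖z - f s‖) ∘ f) x‖ₑ :=
      enorm_sub_le_lintegral_enorm_deriv_of_real
        (absolutelyContinuousOnInterval_lipschitz_comp hφ hf) hs ht
    _ ≤ ∫⁻ x in Ioo 0 L, ‖deriv f x‖ₑ := by
      refine lintegral_mono_ae ?_
      filter_upwards [ae_differentiableAt_of_absolutelyContinuousOnInterval hf] with x hx
      simpa using enorm_deriv_lipschitz_comp_le hφ hx

end AbsolutelyContinuous

section SobolevSq

variable {E F : Type*} [NormedAddCommGroup E] [NormedSpace ℝ E] [NormedAddCommGroup F]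
  [NormedSpace ℝ F] {L : ℝ} {f g : ℝ → E}

/-- The squared norm of `H¹(0, L)`, for functions with values in a normed space. -/
def sobolevSq {E : Type*} [NormedAddCommGroup E] [NormedSpace ℝ E] (L : ℝ) (f : ℝ → E) : ℝ≥0∞ :=
  ∫⁻ t in Ioo 0 L, (‖f t‖ₑ ^ 2 + ‖deriv f t‖ₑ ^ 2)

lemma eqOn_deriv_Ioo (h : EqOn f g (Icc 0 L)) : EqOn (deriv f) (deriv g) (Ioo 0 L) := fun _ ht =>
  (h.eventuallyEq_of_mem (Icc_mem_nhds ht.1 ht.2)).deriv_eq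

lemma sobolevSq_congr (h : EqOn f g (Icc 0 L)) : sobolevSq L f = sobolevSq L g :=
  setLIntegral_congr_fun measurableSet_Ioo fun t ht => by
    simp only [h (Ioo_subset_Icc_self ht), eqOn_deriv_Ioo h ht]

lemma measurable_enorm_deriv_sq [CompleteSpace E] (f : ℝ → E) :
    Measurable fun t => ‖deriv f t‖ₑ ^ 2 :=
  (stronglyMeasurable_deriv f).enorm.pow_const 2

lemma sobolevSq_eq_add [CompleteSpace E] (L : ℝ) (f : ℝ → E) :
    sobolevSq L f = (∫⁻ t in Ioo 0 L, ‖f t‖ₑ ^ 2) + ∫⁻ t in Ioo 0 L, ‖deriv f t‖ₑ ^ 2 :=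
  lintegral_add_right _ (measurable_enorm_deriv_sq f)

lemma aemeasurable_sobolevSq [CompleteSpace E] (hf : AbsolutelyContinuousOnInterval f 0 L) :
    AEMeasurable (fun t => ‖f t‖ₑ ^ 2 + ‖deriv f t‖ₑ ^ 2) (volume.restrict (Ioo 0 L)) := by
  have hcont : ContinuousOn f (Ioo 0 L) :=
    hf.continuousOn.mono (Ioo_subset_Icc_self.trans Icc_subset_uIcc)
  exact ((hcont.aestronglyMeasurable measurableSet_Ioo).enorm.pow_const 2).add
    (measurable_enorm_deriv_sq f).aemeasurable

lemma enorm_sq_add_enorm_deriv_sq_lipschitz_comp_le {φ : E → F} {K : NNReal}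
    (hφ : LipschitzWith K φ) (hφ0 : φ 0 = 0) {t : ℝ} (hf : DifferentiableAt ℝ f t) :
    ‖(φ ∘ f) t‖ₑ ^ 2 + ‖deriv (φ ∘ f) t‖ₑ ^ 2 ≤ K ^ 2 * (‖f t‖ₑ ^ 2 + ‖deriv f t‖ₑ ^ 2) := by
  have hval : ‖φ (f t)‖ₑ ≤ K * ‖f t‖ₑ := by simpa [edist_eq_enorm_sub, hφ0] using hφ (f t) 0
  rw [mul_add, ← mul_pow, ← mul_pow]
  exact add_le_add (pow_le_pow_left' hval 2)
    (pow_le_pow_left' (enorm_deriv_lipschitz_comp_le hφ hf) 2)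

lemma enorm_deriv_norm_sq_le {t : ℝ} (hf : DifferentiableAt ℝ (fun t => ‖f t‖) t)
    (hft : DifferentiableAt ℝ f t) :
    ‖deriv (fun t => ‖f t‖ * ‖f t‖) t‖ₑ ≤ ‖f t‖ₑ ^ 2 + ‖deriv f t‖ₑ ^ 2 := by
  have hderiv : ‖deriv (fun t => ‖f t‖) t‖ₑ ≤ ‖deriv f t‖ₑ := by
    simpa [Function.comp_def] using enorm_deriv_lipschitz_comp_le lipschitzWith_one_norm hft
  have hyoung := ENNReal.young_inequality ‖f t‖ₑ ‖deriv f t‖ₑ Real.HolderConjugate.two_two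
  calc ‖deriv (fun t => ‖f t‖ * ‖f t‖) t‖ₑ = 2 * (‖f t‖ₑ * ‖deriv (fun t => ‖f t‖) t‖ₑ) := by
        rw [deriv_fun_mul hf hf, mul_comm (deriv _ t), ← two_mul, enorm_mul, enorm_mul, enorm_norm]
        simp [Real.enorm_eq_ofReal]
    _ ≤ 2 * (‖f t‖ₑ * ‖deriv f t‖ₑ) := by gcongr
    _ ≤ 2 * (‖f t‖ₑ ^ (2 : ℝ) / ENNReal.ofReal 2 + ‖deriv f t‖ₑ ^ (2 : ℝ) / ENNReal.ofReal 2) := by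
      gcongr
    _ = ‖f t‖ₑ ^ 2 + ‖deriv f t‖ₑ ^ 2 := by simp [mul_add, ENNReal.mul_div_cancel]

lemma countable_zero_and_deriv_ne_zero (f : ℝ → E) : {t | f t = 0 ∧ deriv f t ≠ 0}.Countable := by
  refine (countable_setOfPred_isolated_right_within (s := {t | f t = 0})).mono ?_
  rintro t ⟨hzero, hderiv⟩
  refine ⟨hzero, empty_mem_iff_bot.1 ?_⟩
  have hne : {t | f t = 0}ᶜ ∈ 𝓝[{t | f t = 0} ∩ Ioi t] t :=
    nhdsWithin_mono t (fun x hx => (ne_of_gt hx.2 : x ≠ t))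
      ((differentiableAt_of_deriv_ne_zero hderiv).hasDerivAt.eventually_ne hderiv)
  filter_upwards [hne, self_mem_nhdsWithin] with x hx hx'
  exact hx hx'.1

lemma enorm_add_sq_le {E : Type*} [NormedAddCommGroup E] (x y : E) :
    ‖x + y‖ₑ ^ 2 ≤ 2 * (‖x‖ₑ ^ 2 + ‖y‖ₑ ^ 2) := by
  refine (pow_le_pow_left' (enorm_add_le x y) 2).trans ?_
  simpa [show (2 - 1 : ℝ) = 1 by norm_num] using
    ENNReal.rpow_add_le_mul_rpow_add_rpow ‖x‖ₑ ‖y‖ₑ one_le_two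

variable [FiniteDimensional ℝ E]

lemma sobolevSq_add_le (hf : AbsolutelyContinuousOnInterval f 0 L)
    (hg : AbsolutelyContinuousOnInterval g 0 L) :
    sobolevSq L (f + g) ≤ 2 * (sobolevSq L f + sobolevSq L g) := by
  have := FiniteDimensional.complete ℝ E
  rw [sobolevSq, sobolevSq, sobolevSq, ← lintegral_add_left' (aemeasurable_sobolevSq hf),
    ← lintegral_const_mul' _ _ ENNReal.ofNat_ne_top]
  refine lintegral_mono_ae ?_
  filter_upwards [ae_differentiableAt_of_absolutelyContinuousOnInterval hf,
    ae_differentiableAt_of_absolutelyContinuousOnInterval hg] with t hft hgt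
  rw [deriv_add hft hgt]
  calc ‖f t + g t‖ₑ ^ 2 + ‖deriv f t + deriv g t‖ₑ ^ 2
      ≤ 2 * (‖f t‖ₑ ^ 2 + ‖g t‖ₑ ^ 2) + 2 * (‖deriv f t‖ₑ ^ 2 + ‖deriv g t‖ₑ ^ 2) :=
        add_le_add (enorm_add_sq_le _ _) (enorm_add_sq_le _ _)
    _ = 2 * (‖f t‖ₑ ^ 2 + ‖deriv f t‖ₑ ^ 2 + (‖g t‖ₑ ^ 2 + ‖deriv g t‖ₑ ^ 2)) := by ring

lemma sobolevSq_lipschitz_comp_le {φ : E → F} {K : NNReal} (hφ : LipschitzWith K φ)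
    (hφ0 : φ 0 = 0) (hf : AbsolutelyContinuousOnInterval f 0 L) :
    sobolevSq L (φ ∘ f) ≤ K ^ 2 * sobolevSq L f := by
  rw [sobolevSq, sobolevSq, ← lintegral_const_mul' _ _ (ENNReal.pow_ne_top ENNReal.coe_ne_top)]
  refine lintegral_mono_ae ?_
  filter_upwards [ae_differentiableAt_of_absolutelyContinuousOnInterval hf] with t ht
  exact enorm_sq_add_enorm_deriv_sq_lipschitz_comp_le hφ hφ0 ht

lemma enorm_sq_le_add_sobolevSq (hf : AbsolutelyContinuousOnInterval f 0 L) {s t : ℝ}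
    (hs : s ∈ Icc 0 L) (ht : t ∈ Icc 0 L) : ‖f s‖ₑ ^ 2 ≤ ‖f t‖ₑ ^ 2 + sobolevSq L f := by
  have hnorm : LipschitzWith 1 fun z : E => ‖z‖ := lipschitzWith_one_norm
  have hac : AbsolutelyContinuousOnInterval (fun t => ‖f t‖) 0 L :=
    absolutelyContinuousOnInterval_lipschitz_comp hnorm hf
  have hosc : ‖‖f s‖ * ‖f s‖ - ‖f t‖ * ‖f t‖‖ₑ ≤ sobolevSq L f := by
    refine (enorm_sub_le_lintegral_enorm_deriv (hac.fun_mul hac) ht hs).trans ?_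
    refine lintegral_mono_ae ?_
    filter_upwards [ae_differentiableAt_of_absolutelyContinuousOnInterval hac,
      ae_differentiableAt_of_absolutelyContinuousOnInterval hf] with x hx hfx
    exact enorm_deriv_norm_sq_le hx hfx
  calc ‖f s‖ₑ ^ 2 = ‖‖f t‖ * ‖f t‖ + (‖f s‖ * ‖f s‖ - ‖f t‖ * ‖f t‖)‖ₑ := by
        simp [sq, enorm_mul]
    _ ≤ ‖‖f t‖ * ‖f t‖‖ₑ + ‖‖f s‖ * ‖f s‖ - ‖f t‖ * ‖f t‖‖ₑ := enorm_add_le _ _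
    _ ≤ ‖f t‖ₑ ^ 2 + sobolevSq L f := by
      refine add_le_add (le_of_eq ?_) hosc
      simp [sq, enorm_mul]

end SobolevSq

section IntervalH1

lemma eLpNorm_two_sq {α E : Type*} [MeasurableSpace α] {μ : Measure α} [NormedAddCommGroup E]
    (f : α → E) : eLpNorm f 2 μ ^ 2 = ∫⁻ x, ‖f x‖ₑ ^ 2 ∂μ := by
  simpa using eLpNorm_nnreal_pow_eq_lintegral (f := f) (μ := μ) (p := 2) two_ne_zero

variable {L : ℝ} {f g : ℝ → ℂ}

lemma IntervalH1.congr (hf : IntervalH1 L f) (hL : 0 ≤ L) (h : EqOn f g (Icc 0 L)) :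
    IntervalH1 L g := by
  refine ⟨absolutelyContinuousOnInterval_congr hf.1 (by rwa [uIcc_of_le hL]),
    (memLp_congr_ae ?_).1 hf.2⟩
  filter_upwards [ae_restrict_mem measurableSet_Ioo] with t ht
  exact eqOn_deriv_Ioo h ht

lemma IntervalH2.congr (hf : IntervalH2 L f) (hL : 0 ≤ L) (h : EqOn f g (Icc 0 L)) :
    IntervalH2 L g := by
  obtain ⟨hf1, u, hu, hfu⟩ := hf
  refine ⟨hf1.congr hL h, u, hu, ?_⟩
  filter_upwards [hfu, ae_restrict_mem measurableSet_Ioo] with t hfut ht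
  rw [← hfut, eqOn_deriv_Ioo h ht]

lemma memLp_two_of_continuousOn (hf : ContinuousOn f (Icc 0 L)) :
    MemLp f 2 (volume.restrict (Ioo 0 L)) := by
  obtain ⟨C, hC⟩ := isCompact_Icc.exists_bound_of_continuousOn hf
  refine MemLp.of_bound
    ((hf.mono Ioo_subset_Icc_self).aestronglyMeasurable measurableSet_Ioo) C ?_
  filter_upwards [ae_restrict_mem measurableSet_Ioo] with t ht
  exact hC t (Ioo_subset_Icc_self ht)

lemma intervalH1_of_contDiff (hf : ContDiff ℝ 1 f) : IntervalH1 L f :=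
  ⟨hf.contDiffOn.absolutelyContinuousOnInterval,
    memLp_two_of_continuousOn (hf.continuous_deriv le_rfl).continuousOn⟩

lemma intervalH2_of_contDiff (hf : ContDiff ℝ 2 f) : IntervalH2 L f := by
  have hf' : ContDiff ℝ (1 + 1) f := by rwa [one_add_one_eq_two]
  exact ⟨intervalH1_of_contDiff (hf.of_le one_le_two), deriv f,
    intervalH1_of_contDiff (contDiff_succ_iff_deriv.1 hf').2.2, ae_eq_rfl⟩

lemma IntervalH1.sub (hf : IntervalH1 L f) (hg : IntervalH1 L g) : IntervalH1 L (f - g) := by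
  refine ⟨hf.1.sub hg.1, (memLp_congr_ae ?_).1 (hf.2.sub hg.2)⟩
  filter_upwards [ae_differentiableAt_of_absolutelyContinuousOnInterval hf.1,
    ae_differentiableAt_of_absolutelyContinuousOnInterval hg.1] with t hft hgt
  exact (deriv_sub hft hgt).symm

lemma IntervalH1.lipschitz_comp {φ : ℂ → ℂ} {K : NNReal} (hf : IntervalH1 L f)
    (hφ : LipschitzWith K φ) : IntervalH1 L (φ ∘ f) := by
  refine ⟨absolutelyContinuousOnInterval_lipschitz_comp hφ hf.1,
    hf.2.of_le_mul (measurable_deriv _).aestronglyMeasurable (c := K) ?_⟩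
  filter_upwards [ae_differentiableAt_of_absolutelyContinuousOnInterval hf.1] with t ht
  exact norm_deriv_lipschitz_comp_le hφ ht

lemma IntervalH1.sobolevSq_lt_top (hf : IntervalH1 L f) : sobolevSq L f < ∞ := by
  have hmem := memLp_two_of_continuousOn (hf.1.continuousOn.mono Icc_subset_uIcc)
  rw [sobolevSq_eq_add, ← eLpNorm_two_sq, ← eLpNorm_two_sq]
  exact ENNReal.add_lt_top.2 ⟨ENNReal.pow_lt_top hmem.2, ENNReal.pow_lt_top hf.2.2⟩

end IntervalH1

section Smoothing

lemma lintegral_sq_le_measure_univ_mul {α : Type*} [MeasurableSpace α] {μ : Measure α}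
    {u : α → ℝ≥0∞} (hu : AEMeasurable u μ) :
    (∫⁻ x, u x ∂μ) ^ 2 ≤ μ univ * ∫⁻ x, u x ^ 2 ∂μ := by
  have h := ENNReal.lintegral_mul_le_Lp_mul_Lq μ Real.HolderConjugate.two_two (f := 1)
    aemeasurable_const hu
  simp only [Pi.mul_apply, Pi.one_apply, one_mul, ENNReal.one_rpow, lintegral_const] at h
  calc (∫⁻ x, u x ∂μ) ^ 2
      ≤ (μ univ ^ (1 / 2 : ℝ) * (∫⁻ x, u x ^ (2 : ℝ) ∂μ) ^ (1 / 2 : ℝ)) ^ 2 := by gcongr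
    _ = μ univ * ∫⁻ x, u x ^ 2 ∂μ := by
      rw [mul_pow, ← ENNReal.rpow_natCast, ← ENNReal.rpow_natCast, ← ENNReal.rpow_mul,
        ← ENNReal.rpow_mul]
      simp

-- Approximating `u / ρ` in `L²(ρ² dt)` amounts to approximating `u` by multiples of `ρ`.
lemma exists_contDiff_lintegral_sub_mul_le {L : ℝ} {u ρ : ℝ → ℂ}
    (hu : MemLp u 2 (volume.restrict (Ioo 0 L))) (hρ : Continuous ρ)
    (hρ0 : ∀ t ∈ Ioo 0 L, ρ t ≠ 0) {δ : ℝ≥0∞} (hδ : δ ≠ 0) :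
    ∃ q : ℝ → ℂ, ContDiff ℝ 1 q ∧ (∫⁻ t in Ioo 0 L, ‖u t - ρ t * q t‖ₑ ^ 2) ≤ δ := by
  let μ : Measure ℝ := volume.restrict (Ioo 0 L)
  let ν : Measure ℝ := μ.withDensity fun t => ‖ρ t‖ₑ ^ 2
  have hν (v : ℝ → ℂ) : ∫⁻ t, ‖v t‖ₑ ^ 2 ∂ν = ∫⁻ t, ‖ρ t * v t‖ₑ ^ 2 ∂μ := by
    rw [lintegral_withDensity_eq_lintegral_mul_non_measurable _ (by fun_prop) (by simp)]
    simp only [Pi.mul_apply, enorm_mul, mul_pow]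
  have hfin : IsFiniteMeasure ν := by
    refine isFiniteMeasure_withDensity (lt_top_iff_ne_top.1 ?_)
    have hint : IntegrableOn (fun t => ρ t ^ 2) (Ioo 0 L) :=
      (hρ.pow 2).integrableOn_Icc.mono_set Ioo_subset_Icc_self
    simpa only [HasFiniteIntegral, enorm_pow] using hint.2
  have hquot : ∀ᵐ t ∂μ, ρ t * (u t / ρ t) = u t := by
    filter_upwards [ae_restrict_mem measurableSet_Ioo] with t ht
    exact mul_div_cancel₀ _ (hρ0 t ht)
  have hmem : MemLp (fun t => u t / ρ t) 2 ν := by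
    refine ⟨(hu.1.div₀ hρ.aestronglyMeasurable).mono_ac (withDensity_absolutelyContinuous _ _), ?_⟩
    refine (ENNReal.pow_lt_top_iff.1 ?_).resolve_right two_ne_zero
    rw [eLpNorm_two_sq, hν,
      lintegral_congr_ae (g := fun t => ‖u t‖ₑ ^ 2) (hquot.mono fun t ht => by simp only [ht]),
      ← eLpNorm_two_sq]
    exact ENNReal.pow_lt_top hu.2
  obtain ⟨η, hη0, hηδ⟩ := ENNReal.lt_iff_exists_nnreal_btwn.1 (pos_iff_ne_zero.2 hδ)
  obtain ⟨q, -, hq, hle⟩ := hmem.exist_eLpNorm_sub_le ENNReal.ofNat_ne_top one_le_two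
    (Real.sqrt_pos.2 (NNReal.coe_pos.2 (ENNReal.coe_pos.1 hη0)))
  refine ⟨q, hq.of_le (by exact_mod_cast le_top), ?_⟩
  calc ∫⁻ t in Ioo 0 L, ‖u t - ρ t * q t‖ₑ ^ 2
      = ∫⁻ t, ‖u t / ρ t - q t‖ₑ ^ 2 ∂ν := by
        rw [hν]
        exact lintegral_congr_ae (hquot.mono fun t ht => by simp only [mul_sub, ht])
    _ = eLpNorm ((fun t => u t / ρ t) - q) 2 ν ^ 2 := (eLpNorm_two_sq _).symm
    _ ≤ ENNReal.ofReal (√η) ^ 2 := by gcongr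
    _ = η := by rw [← ENNReal.ofReal_pow (Real.sqrt_nonneg _), Real.sq_sqrt η.coe_nonneg,
      ENNReal.ofReal_coe_nnreal]
    _ ≤ δ := hηδ.le

variable {L : ℝ} {f : ℝ → ℂ}

lemma enorm_sq_le_mul_lintegral_enorm_deriv_sq (hf : AbsolutelyContinuousOnInterval f 0 L)
    (hf0 : f 0 = 0) {t : ℝ} (ht : t ∈ Icc 0 L) :
    ‖f t‖ₑ ^ 2 ≤ ENNReal.ofReal L * ∫⁻ t in Ioo 0 L, ‖deriv f t‖ₑ ^ 2 := by
  have hosc := enorm_sub_le_lintegral_enorm_deriv hf ⟨le_rfl, ht.1.trans ht.2⟩ ht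
  rw [hf0, sub_zero] at hosc
  have hcs := lintegral_sq_le_measure_univ_mul (μ := volume.restrict (Ioo 0 L))
    (measurable_deriv f).enorm.aemeasurable
  rw [Measure.restrict_apply_univ, Real.volume_Ioo, sub_zero] at hcs
  exact (pow_le_pow_left' hosc 2).trans hcs

lemma sobolevSq_le_mul_lintegral_enorm_deriv_sq (hf : AbsolutelyContinuousOnInterval f 0 L)
    (hf0 : f 0 = 0) :
    sobolevSq L f ≤ (ENNReal.ofReal L ^ 2 + 1) * ∫⁻ t in Ioo 0 L, ‖deriv f t‖ₑ ^ 2 := by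
  rw [sobolevSq_eq_add, add_mul, one_mul]
  gcongr
  calc ∫⁻ t in Ioo 0 L, ‖f t‖ₑ ^ 2
      ≤ ∫⁻ _ in Ioo 0 L, ENNReal.ofReal L * ∫⁻ t in Ioo 0 L, ‖deriv f t‖ₑ ^ 2 :=
        setLIntegral_mono' measurableSet_Ioo fun t ht =>
          enorm_sq_le_mul_lintegral_enorm_deriv_sq hf hf0 (Ioo_subset_Icc_self ht)
    _ = ENNReal.ofReal L ^ 2 * ∫⁻ t in Ioo 0 L, ‖deriv f t‖ₑ ^ 2 := by
      rw [setLIntegral_const, Real.volume_Ioo, sub_zero]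
      ring

lemma IntervalH1.exists_contDiff_lintegral_enorm_deriv_sub_sq_le (hf : IntervalH1 L f)
    {δ : ℝ≥0∞} (hδ : δ ≠ 0) :
    ∃ g : ℝ → ℂ, ContDiff ℝ 2 g ∧ g 0 = f 0 ∧ deriv g 0 = 0 ∧ deriv g L = 0 ∧
      ∫⁻ t in Ioo 0 L, ‖deriv (f - g) t‖ₑ ^ 2 ≤ δ := by
  let ρ : ℝ → ℂ := fun t => (t * (L - t) : ℝ)
  have hρ : ContDiff ℝ 1 ρ := Complex.ofRealCLM.contDiff.comp
    (by fun_prop : ContDiff ℝ 1 fun t : ℝ => t * (L - t))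
  have hρ0 : ∀ t ∈ Ioo 0 L, ρ t ≠ 0 := fun t ht =>
    Complex.ofReal_ne_zero.2 (mul_pos ht.1 (sub_pos.2 ht.2)).ne'
  obtain ⟨q, hq, hle⟩ := exists_contDiff_lintegral_sub_mul_le hf.2 hρ.continuous hρ0 hδ
  let g : ℝ → ℂ := fun t => f 0 + ∫ x in 0..t, ρ x * q x
  have hg (t : ℝ) : HasDerivAt g (ρ t * q t) t :=
    ((hρ.continuous.mul hq.continuous).integral_hasStrictDerivAt 0 t).hasDerivAt.const_add _
  have hg' : deriv g = fun t => ρ t * q t := funext fun t => (hg t).deriv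
  have hg2 : ContDiff ℝ (1 + 1) g := contDiff_succ_iff_deriv.2
    ⟨fun t => (hg t).differentiableAt, by simp, hg' ▸ hρ.mul hq⟩
  rw [one_add_one_eq_two] at hg2
  refine ⟨g, hg2, by simp [g], by simp [hg', ρ], by simp [hg', ρ], le_trans (le_of_eq ?_) hle⟩
  refine lintegral_congr_ae ?_
  filter_upwards [ae_differentiableAt_of_absolutelyContinuousOnInterval hf.1] with t ht
  rw [deriv_sub ht (hg t).differentiableAt, (hg t).deriv]

lemma exists_contDiff_step (hL : 0 < L) : ∃ s : ℝ → ℂ, ContDiff ℝ 2 s ∧ s 0 = 0 ∧ s L = 1 ∧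
    deriv s 0 = 0 ∧ deriv s L = 0 := by
  let s : ℝ → ℂ := fun t => ((3 * (t / L) ^ 2 - 2 * (t / L) ^ 3 : ℝ) : ℂ)
  have hs (t : ℝ) : HasDerivAt s ((6 * (t / L) * (1 - t / L) / L : ℝ) : ℂ) t := by
    have hdiv : HasDerivAt (fun t : ℝ => t / L) (1 / L) t := (hasDerivAt_id t).div_const L
    refine HasDerivAt.ofReal_comp ?_
    exact (((hdiv.pow 2).const_mul 3).sub ((hdiv.pow 3).const_mul 2)).congr_deriv (by ring)
  have hs2 : ContDiff ℝ 2 s := Complex.ofRealCLM.contDiff.comp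
    (by fun_prop : ContDiff ℝ 2 fun t : ℝ => 3 * (t / L) ^ 2 - 2 * (t / L) ^ 3)
  refine ⟨s, hs2, by simp [s], ?_, by simp [(hs 0).deriv], ?_⟩
  · norm_num [s, hL.ne']
  · simp [(hs L).deriv, hL.ne']

lemma sobolevSq_sub_mul_le (hL : 0 ≤ L) {s : ℝ → ℂ} (hf : AbsolutelyContinuousOnInterval f 0 L)
    (hf0 : f 0 = 0) (hs : AbsolutelyContinuousOnInterval s 0 L) :
    sobolevSq L (fun t => f t - f L * s t) ≤
      2 * (ENNReal.ofReal L ^ 2 + 1 + ENNReal.ofReal L * sobolevSq L s) *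
        ∫⁻ t in Ioo 0 L, ‖deriv f t‖ₑ ^ 2 := by
  let c : ℂ → ℂ := (-f L • ·)
  have hc : LipschitzWith ‖-f L‖₊ c := lipschitzWith_smul _
  have hsplit : (fun t => f t - f L * s t) = f + c ∘ s := by
    ext t
    simp only [c, Pi.add_apply, Function.comp_apply, smul_eq_mul]
    ring
  let I := ∫⁻ t in Ioo 0 L, ‖deriv f t‖ₑ ^ 2
  calc sobolevSq L (fun t => f t - f L * s t) ≤ 2 * (sobolevSq L f + sobolevSq L (c ∘ s)) :=
        hsplit ▸ sobolevSq_add_le hf (absolutelyContinuousOnInterval_lipschitz_comp hc hs)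
    _ ≤ 2 * ((ENNReal.ofReal L ^ 2 + 1) * I + ‖f L‖ₑ ^ 2 * sobolevSq L s) := by
      gcongr
      · exact sobolevSq_le_mul_lintegral_enorm_deriv_sq hf hf0
      · simpa [enorm] using sobolevSq_lipschitz_comp_le hc (smul_zero _) hs
    _ ≤ 2 * ((ENNReal.ofReal L ^ 2 + 1) * I + ENNReal.ofReal L * I * sobolevSq L s) := by
      gcongr
      exact enorm_sq_le_mul_lintegral_enorm_deriv_sq hf hf0 ⟨hL, le_rfl⟩
    _ = 2 * (ENNReal.ofReal L ^ 2 + 1 + ENNReal.ofReal L * sobolevSq L s) * I := by ring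

lemma IntervalH1.exists_contDiff_approx (hL : 0 < L) (hf : IntervalH1 L f) {δ : ℝ≥0∞}
    (hδ : δ ≠ 0) :
    ∃ g : ℝ → ℂ, ContDiff ℝ 2 g ∧ g 0 = f 0 ∧ g L = f L ∧ deriv g 0 = 0 ∧ deriv g L = 0 ∧
      sobolevSq L (f - g) ≤ δ := by
  obtain ⟨s, hs, hs0, hsL, hs0', hsL'⟩ := exists_contDiff_step hL
  have hsH1 : IntervalH1 L s := intervalH1_of_contDiff (hs.of_le one_le_two)
  let M : ℝ≥0∞ := 2 * (ENNReal.ofReal L ^ 2 + 1 + ENNReal.ofReal L * sobolevSq L s)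
  have hM : M ≠ ∞ := by
    have := hsH1.sobolevSq_lt_top.ne
    finiteness
  obtain ⟨g, hg, hg0, hg0', hgL', hle⟩ :=
    hf.exists_contDiff_lintegral_enorm_deriv_sub_sq_le (ENNReal.div_ne_zero.2 ⟨hδ, hM⟩)
  let h : ℝ → ℂ := f - g
  have hh : IntervalH1 L h := hf.sub (intervalH1_of_contDiff (hg.of_le one_le_two))
  let k : ℝ → ℂ := fun t => g t + h L * s t
  have hk : f - k = fun t => h t - h L * s t := by
    ext t
    simp only [k, h, Pi.sub_apply]
    ring
  have hk' (t : ℝ) : HasDerivAt k (deriv g t + h L * deriv s t) t :=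
    ((hg.differentiable two_ne_zero) t).hasDerivAt.add
      (((hs.differentiable two_ne_zero) t).hasDerivAt.const_mul _)
  refine ⟨k, hg.add (contDiff_const.mul hs), by simp [k, hs0, hg0], by simp [k, h, hsL],
    by simp [(hk' 0).deriv, hg0', hs0'], by simp [(hk' L).deriv, hgL', hsL'], ?_⟩
  calc sobolevSq L (f - k) ≤ M * ∫⁻ t in Ioo 0 L, ‖deriv h t‖ₑ ^ 2 :=
        hk ▸ sobolevSq_sub_mul_le hL.le hh.1 (sub_eq_zero.2 hg0.symm) hsH1.1
    _ ≤ M * (δ / M) := by gcongr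
    _ ≤ δ := ENNReal.mul_div_le

end Smoothing

section Clip

variable {E : Type*} [NormedAddCommGroup E] [NormedSpace ℝ E]

/-- The radial retraction of a normed space onto its closed ball of radius `r > 0`; subtracting it
cuts off the small values of a function. -/
def clip (r : ℝ) (z : E) : E := (r / max r ‖z‖) • z

lemma clip_of_norm_le {r : ℝ} {z : E} (hr : 0 < r) (hz : ‖z‖ ≤ r) : clip r z = z := by
  rw [clip, max_eq_left hz, div_self hr.ne', one_smul]

lemma ofReal_sq_le_enorm_sq_of_clip_ne {r : ℝ} (hr : 0 < r) {z : E}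
    (hz : clip r z ≠ z) : ENNReal.ofReal r ^ 2 ≤ ‖z‖ₑ ^ 2 := by
  rw [← ofReal_norm]
  gcongr
  exact (not_le.1 (mt (clip_of_norm_le hr) hz)).le

lemma clip_of_le_norm {r : ℝ} {z : E} (hz : r ≤ ‖z‖) : clip r z = r • (‖z‖⁻¹ • z) := by
  rw [clip, max_eq_right hz, div_eq_mul_inv, mul_smul]

@[simp]
lemma clip_zero (r : ℝ) : clip r (0 : E) = 0 := smul_zero _

lemma lipschitzWith_clip {r : ℝ} (hr : 0 < r) : LipschitzWith 2 (clip r : E → E) := by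
  refine LipschitzWith.of_dist_le_mul fun z w => ?_
  have hmz : 0 < max r ‖z‖ := lt_max_of_lt_left hr
  have hmw : 0 < max r ‖w‖ := lt_max_of_lt_left hr
  have hscale : |r / max r ‖z‖| ≤ 1 := by
    rw [abs_of_nonneg (by positivity)]
    exact div_le_one_of_le₀ (le_max_left _ _) hmz.le
  have hmax : |max r ‖w‖ - max r ‖z‖| ≤ ‖z - w‖ := by
    rw [abs_sub_comm]
    refine (abs_max_sub_max_le_max r ‖z‖ r ‖w‖).trans ?_
    simpa using abs_norm_sub_norm_le z w
  have hsplit : clip r z - clip r w = (r / max r ‖z‖) • (z - w) +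
      (r / max r ‖z‖ * ((max r ‖w‖ - max r ‖z‖) * (max r ‖w‖)⁻¹)) • w := by
    simp only [clip]
    rw [smul_sub, sub_add, ← sub_smul]
    congr 2
    field_simp
    ring
  calc dist (clip r z) (clip r w)
      ≤ |r / max r ‖z‖| * ‖z - w‖ +
        |r / max r ‖z‖| * (|max r ‖w‖ - max r ‖z‖| * ((max r ‖w‖)⁻¹ * ‖w‖)) := by
        rw [dist_eq_norm, hsplit]
        refine (norm_add_le _ _).trans (le_of_eq ?_)
        rw [norm_smul, norm_smul, norm_mul, norm_mul, norm_inv, Real.norm_of_nonneg hmw.le,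
          Real.norm_eq_abs, Real.norm_eq_abs, mul_assoc, mul_assoc]
    _ ≤ 1 * ‖z - w‖ + 1 * (‖z - w‖ * 1) := by
      gcongr
      exact inv_mul_le_one_of_le₀ (le_max_right _ _) hmw.le
    _ = (2 : NNReal) * dist z w := by rw [dist_eq_norm, NNReal.coe_ofNat]; ring

variable {L : ℝ} {f : ℝ → E}

lemma ae_deriv_eq_zero_of_eq_zero (f : ℝ → E) : ∀ᵐ t, f t = 0 → deriv f t = 0 := by
  filter_upwards [(countable_zero_and_deriv_ne_zero f).ae_notMem volume] with t ht h0
  exact not_not.1 fun hderiv => ht ⟨h0, hderiv⟩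

lemma tendsto_enorm_sq_add_enorm_deriv_sq_clip {t : ℝ} (ht : DifferentiableAt ℝ f t)
    (h0 : f t = 0 → deriv f t = 0) :
    Tendsto (fun r => ‖(clip r ∘ f) t‖ₑ ^ 2 + ‖deriv (clip r ∘ f) t‖ₑ ^ 2) (𝓝[>] 0) (𝓝 0) := by
  by_cases hft : f t = 0
  · refine tendsto_const_nhds.congr' ?_
    filter_upwards [self_mem_nhdsWithin] with r hr
    refine (nonpos_iff_eq_zero.1 ?_).symm
    simpa [hft, h0 hft] using
      enorm_sq_add_enorm_deriv_sq_lipschitz_comp_le (lipschitzWith_clip hr) (clip_zero r) ht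
  · let u : ℝ → E := fun x => ‖f x‖⁻¹ • f x
    have hlim : Tendsto (fun r : ℝ => ‖r • u t‖ₑ ^ 2 + ‖r • deriv u t‖ₑ ^ 2) (𝓝[>] 0) (𝓝 0) := by
      have hcont : Continuous fun r : ℝ => ‖r • u t‖ₑ ^ 2 + ‖r • deriv u t‖ₑ ^ 2 := by fun_prop
      simpa using (hcont.tendsto 0).mono_left nhdsWithin_le_nhds
    refine hlim.congr' ?_
    filter_upwards [nhdsWithin_le_nhds (Iio_mem_nhds (norm_pos_iff.2 hft))] with r hr
    have hclip : clip r ∘ f =ᶠ[𝓝 t] r • u := by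
      filter_upwards [ht.continuousAt.norm.eventually_const_lt hr] with x hx
      exact clip_of_le_norm hx.le
    rw [hclip.deriv_eq, hclip.eq_of_nhds, Pi.smul_apply, deriv_const_smul_field]

lemma tendsto_sobolevSq_clip_comp [FiniteDimensional ℝ E]
    (hf : AbsolutelyContinuousOnInterval f 0 L) (hfin : sobolevSq L f ≠ ∞) :
    Tendsto (fun r => sobolevSq L (clip r ∘ f)) (𝓝[>] 0) (𝓝 0) := by
  have := FiniteDimensional.complete ℝ E
  have hdiff := ae_differentiableAt_of_absolutelyContinuousOnInterval hf
  rw [← lintegral_zero (μ := volume.restrict (Ioo 0 L))]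
  refine tendsto_lintegral_filter_of_dominated_convergence'
    (fun t => 2 ^ 2 * (‖f t‖ₑ ^ 2 + ‖deriv f t‖ₑ ^ 2)) ?_ ?_ ?_ ?_
  · filter_upwards [self_mem_nhdsWithin] with r hr
    exact aemeasurable_sobolevSq
      (absolutelyContinuousOnInterval_lipschitz_comp (lipschitzWith_clip hr) hf)
  · filter_upwards [self_mem_nhdsWithin] with r hr
    filter_upwards [hdiff] with t ht
    exact enorm_sq_add_enorm_deriv_sq_lipschitz_comp_le (lipschitzWith_clip hr) (clip_zero r) ht
  · rw [lintegral_const_mul' _ _ (by norm_num)]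
    exact ENNReal.mul_ne_top (by norm_num) hfin
  · filter_upwards [hdiff, ae_restrict_of_ae (ae_deriv_eq_zero_of_eq_zero f)] with t ht h0
    exact tendsto_enorm_sq_add_enorm_deriv_sq_clip ht h0

end Clip

/-! ### Topology of the metric graph -/

section

variable {V : Type*} {Γ : MetricGraph V}

@[simp] lemma param_zero (e : Γ.Edge) : Γ.param e 0 = .vertex (Γ.src e) := by simp [param]

@[simp] lemma param_length (e : Γ.Edge) : Γ.param e (Γ.length e) = .vertex (Γ.tgt e) := by
  simp [param, Γ.length_pos e]

lemma param_of_mem_Ioo {e : Γ.Edge} {t : ℝ} (ht : t ∈ Ioo 0 (Γ.length e)) :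
    Γ.param e t = .inner e t ht := by
  rw [param, dif_neg ht.1.not_ge, dif_neg ht.2.not_ge]

lemma zero_mem_Icc (e : Γ.Edge) : (0 : ℝ) ∈ Icc 0 (Γ.length e) := left_mem_Icc.2 (Γ.length_pos e).le

lemma length_mem_Icc (e : Γ.Edge) : Γ.length e ∈ Icc 0 (Γ.length e) :=
  right_mem_Icc.2 (Γ.length_pos e).le

lemma eq_endpoints_or_mem_Ioo_of_mem_Icc {L t : ℝ} (ht : t ∈ Icc 0 L) :
    t = 0 ∨ t = L ∨ t ∈ Ioo 0 L := by
  rcases ht.1.eq_or_lt with h | h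
  · exact .inl h.symm
  · exact .inr (ht.2.eq_or_lt.imp_right fun h' => ⟨h, h'⟩)

lemma adj_src_tgt (e : Γ.Edge) : Γ.graph.Adj (Γ.src e) (Γ.tgt e) := by
  rw [← SimpleGraph.mem_edgeSet, Γ.mk_src_tgt]
  exact e.2

lemma src_tgt_eq_or_swap {u v : V} (h : Γ.graph.Adj u v) :
    Γ.src ⟨s(u, v), h⟩ = u ∧ Γ.tgt ⟨s(u, v), h⟩ = v ∨
      Γ.src ⟨s(u, v), h⟩ = v ∧ Γ.tgt ⟨s(u, v), h⟩ = u :=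
  Sym2.eq_iff.1 (Γ.mk_src_tgt ⟨s(u, v), h⟩)

lemma finite_neighborSet (Γ : MetricGraph V) (v : V) : (Γ.graph.neighborSet v).Finite := by
  refine Set.Finite.subset ((Γ.locallyFinite v).biUnion fun e _ => toFinite {Γ.src e, Γ.tgt e})
    fun u hu => mem_iUnion₂.2 ⟨⟨s(v, u), hu⟩, Sym2.mem_mk_left v u, ?_⟩
  rcases src_tgt_eq_or_swap hu with ⟨-, h⟩ | ⟨h, -⟩
  · exact .inr h.symm
  · exact .inl h.symm

lemma isOpen_iff {U : Set Γ.Point} :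
    IsOpen U ↔ ∀ e, IsOpen ((fun t : Icc (0 : ℝ) (Γ.length e) => Γ.param e t) ⁻¹' U) := by
  change IsOpen[⨆ e : Γ.Edge, TopologicalSpace.coinduced
    (fun t : Icc (0 : ℝ) (Γ.length e) => Γ.param e t) inferInstance] U ↔ _
  simp only [isOpen_iSup_iff, isOpen_coinduced]

lemma continuousOn_param (e : Γ.Edge) : ContinuousOn (Γ.param e) (Icc 0 (Γ.length e)) :=
  continuousOn_iff_continuous_domRestrict.2 ⟨fun _ hU => isOpen_iff.1 hU e⟩

lemma continuous_iff {f : Γ.Point → ℂ} :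
    Continuous f ↔ ∀ e, ContinuousOn (Γ.onEdge f e) (Icc 0 (Γ.length e)) :=
  ⟨fun h e => h.comp_continuousOn (continuousOn_param e), fun h => ⟨fun U hU => isOpen_iff.2
    fun e => (continuousOn_iff_continuous_domRestrict.1 (h e)).isOpen_preimage U hU⟩⟩

lemma isOpen_of_edges {U : Set Γ.Point}
    (h : ∀ e, (∀ t ∈ Ioo 0 (Γ.length e), Γ.param e t ∈ U) ∨
      ∀ t ∈ Icc 0 (Γ.length e), Γ.param e t ∉ U) : IsOpen U := by
  refine isOpen_iff.2 fun e => ?_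
  rcases h e with hmem | hnotMem
  · refine isClosed_compl_iff.1 (Set.Finite.isClosed (Set.Finite.subset
      (toFinite {⟨0, zero_mem_Icc e⟩, ⟨_, length_mem_Icc e⟩}) fun t ht => ?_))
    rcases eq_endpoints_or_mem_Ioo_of_mem_Icc t.2 with h0 | hL | ht'
    · exact .inl (Subtype.ext h0)
    · exact .inr (Subtype.ext hL)
    · exact (ht (hmem t ht')).elim
  · convert! isOpen_empty
    exact eq_empty_of_forall_notMem fun t => hnotMem t t.2

lemma isClosed_of_edges {A : Set Γ.Point}
    (h : ∀ e, (∀ t ∈ Icc 0 (Γ.length e), Γ.param e t ∈ A) ∨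
      ∀ t ∈ Ioo 0 (Γ.length e), Γ.param e t ∉ A) : IsClosed A :=
  ⟨isOpen_of_edges fun e => (h e).symm.imp_right fun h t ht => not_not.2 (h t ht)⟩

/-- The closed edges which meet a set of points. -/
def edgesMeeting (A : Set Γ.Point) : Set Γ.Edge :=
  {e | ∃ t ∈ Icc 0 (Γ.length e), Γ.param e t ∈ A}

lemma isPreconnected_param_image {e : Γ.Edge} {s : Set ℝ} (hs : s ⊆ Icc 0 (Γ.length e))
    (h : IsPreconnected s) : IsPreconnected (Γ.param e '' s) :=
  h.image _ ((continuousOn_param e).mono hs)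

lemma forall_mem_or_forall_notMem {A : Set Γ.Point} (hA : IsOpen A) {e : Γ.Edge}
    (he : e ∉ edgesMeeting (frontier A)) :
    (∀ t ∈ Icc 0 (Γ.length e), Γ.param e t ∈ A) ∨
      ∀ t ∈ Icc 0 (Γ.length e), Γ.param e t ∉ A := by
  by_contra! h
  obtain ⟨⟨s, hs, hsA⟩, t, ht, htA⟩ := h
  refine hsA ((isPreconnected_param_image Subset.rfl
    isPreconnected_Icc).subset_of_closure_inter_subset hA ⟨_, ⟨t, ht, rfl⟩, htA⟩ ?_ ⟨s, hs, rfl⟩)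
  rintro _ ⟨hclosure, r, hr, rfl⟩
  by_contra hrA
  exact he ⟨r, hr, hclosure, by rwa [hA.interior_eq]⟩

/-- The union of the closed edges in a set of edges. -/
def edgeHull (F : Set Γ.Edge) : Set Γ.Point := ⋃ e ∈ F, Γ.param e '' Icc 0 (Γ.length e)

lemma mem_edgeHull {F : Set Γ.Edge} {p : Γ.Point} :
    p ∈ edgeHull F ↔ ∃ e ∈ F, ∃ t ∈ Icc 0 (Γ.length e), Γ.param e t = p := by
  simp only [edgeHull, mem_iUnion, mem_image, exists_prop]

lemma inner_mem_edgeHull {F : Set Γ.Edge} {e : Γ.Edge} {t : ℝ} {ht : t ∈ Ioo 0 (Γ.length e)} :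
    .inner e t ht ∈ edgeHull F ↔ e ∈ F := by
  refine mem_edgeHull.trans ⟨fun ⟨e', he', s, hs, h⟩ => ?_, fun he =>
    ⟨e, he, t, Ioo_subset_Icc_self ht, param_of_mem_Ioo ht⟩⟩
  rcases eq_endpoints_or_mem_Ioo_of_mem_Icc hs with rfl | rfl | hs'
  · simp at h
  · simp at h
  · rw [param_of_mem_Ioo hs'] at h
    cases h
    exact he'

lemma isClosed_edgeHull (F : Set Γ.Edge) : IsClosed (edgeHull F) := by
  refine isClosed_of_edges fun e => ?_
  by_cases he : e ∈ F
  · exact .inl fun t ht => mem_edgeHull.2 ⟨e, he, t, ht, rfl⟩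
  · refine .inr fun t ht h => he ?_
    rwa [param_of_mem_Ioo ht, inner_mem_edgeHull] at h

lemma isCompact_edgeHull {F : Set Γ.Edge} (hF : F.Finite) : IsCompact (edgeHull F) :=
  hF.isCompact_biUnion fun e _ => isCompact_Icc.image_of_continuousOn (continuousOn_param e)

lemma isClosed_vertex_image (C : Set V) : IsClosed (Point.vertex '' C : Set Γ.Point) :=
  isClosed_of_edges fun e => .inr fun t ht h => by
    rw [param_of_mem_Ioo ht] at h
    simp at h

/-- The edges with an endpoint in a set of vertices. -/
def incidentEdges (Γ : MetricGraph V) (C : Set V) : Set Γ.Edge :=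
  {e | Γ.src e ∈ C ∨ Γ.tgt e ∈ C}

lemma finite_incidentEdges {C : Set V} (hC : C.Finite) : (Γ.incidentEdges C).Finite := by
  refine (hC.biUnion fun v _ => Γ.locallyFinite v).subset fun e he => mem_iUnion₂.2 ?_
  simp only [mem_ofPred_eq, ← Γ.mk_src_tgt e]
  exact he.elim (fun h => ⟨_, h, Sym2.mem_mk_left _ _⟩) fun h => ⟨_, h, Sym2.mem_mk_right _ _⟩

/-- The open star of a set of vertices: these vertices and the interiors of the incident edges. -/
def vertexStar (Γ : MetricGraph V) (C : Set V) : Set Γ.Point :=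
  {p | match p with
    | .vertex v => v ∈ C
    | .inner e _ _ => e ∈ Γ.incidentEdges C}

lemma vertexStar_mono {C C' : Set V} (h : C ⊆ C') : Γ.vertexStar C ⊆ Γ.vertexStar C' := by
  rintro (v | ⟨e, t, ht⟩) hp
  · exact h hp
  · exact hp.imp (fun hsrc => h hsrc) fun htgt => h htgt

lemma param_mem_vertexStar {C : Set V} {e : Γ.Edge} (he : e ∈ Γ.incidentEdges C) {t : ℝ}
    (ht : t ∈ Ioo 0 (Γ.length e)) : Γ.param e t ∈ Γ.vertexStar C := by
  rwa [param_of_mem_Ioo ht]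

lemma edgesMeeting_vertexStar_subset (C : Set V) :
    edgesMeeting (Γ.vertexStar C) ⊆ Γ.incidentEdges C := by
  rintro e ⟨t, ht, h⟩
  rcases eq_endpoints_or_mem_Ioo_of_mem_Icc ht with rfl | rfl | ht'
  · rw [param_zero] at h
    exact .inl h
  · rw [param_length] at h
    exact .inr h
  · rwa [param_of_mem_Ioo ht'] at h

lemma isOpen_vertexStar (C : Set V) : IsOpen (Γ.vertexStar C) := by
  refine isOpen_of_edges fun e => ?_
  by_cases he : e ∈ Γ.incidentEdges C
  · exact .inl fun t ht => param_mem_vertexStar he ht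
  · exact .inr fun t ht h => he (edgesMeeting_vertexStar_subset C ⟨t, ht, h⟩)

lemma finite_edgesMeeting_of_isCompact {K : Set Γ.Point} (hK : IsCompact K) :
    (edgesMeeting K).Finite := by
  obtain ⟨T, hT⟩ := hK.elim_finite_subcover (fun v : V => Γ.vertexStar {v})
    (fun v => isOpen_vertexStar _) (by
      rintro (v | ⟨e, t, ht⟩) -
      · exact mem_iUnion.2 ⟨v, rfl⟩
      · exact mem_iUnion.2 ⟨Γ.src e, .inl rfl⟩)
  have hKT : K ⊆ Γ.vertexStar T := hT.trans <| iUnion₂_subset fun v hv =>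
    vertexStar_mono (singleton_subset_iff.2 hv)
  refine (finite_incidentEdges T.finite_toSet).subset fun e ⟨t, ht, htK⟩ =>
    edgesMeeting_vertexStar_subset _ ⟨t, ht, hKT htK⟩

lemma isConnected_vertexStar_singleton (v : V) : IsConnected (Γ.vertexStar {v}) := by
  refine ⟨⟨.vertex v, rfl⟩, isPreconnected_of_forall (.vertex v) ?_⟩
  rintro (u | ⟨e, t, ht⟩) hp
  · rw [show u = v from hp]
    exact ⟨{.vertex v}, singleton_subset_iff.2 rfl, rfl, rfl, isPreconnected_singleton⟩
  have hstar : ∀ s ∈ Ioo 0 (Γ.length e), Γ.param e s ∈ Γ.vertexStar {v} := fun s hs =>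
    param_mem_vertexStar hp hs
  rcases hp with hsrc | htgt
  · refine ⟨Γ.param e '' Ico 0 (Γ.length e), ?_, ⟨0, ⟨le_rfl, Γ.length_pos e⟩, ?_⟩,
      ⟨t, Ioo_subset_Ico_self ht, param_of_mem_Ioo ht⟩,
      isPreconnected_param_image Ico_subset_Icc_self isPreconnected_Ico⟩
    · rintro _ ⟨s, hs, rfl⟩
      rcases hs.1.eq_or_lt with rfl | hs0
      · rwa [param_zero]
      · exact hstar s ⟨hs0, hs.2⟩
    · rw [param_zero, show Γ.src e = v from hsrc]
  · refine ⟨Γ.param e '' Ioc 0 (Γ.length e), ?_, ⟨_, ⟨Γ.length_pos e, le_rfl⟩, ?_⟩,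
      ⟨t, Ioo_subset_Ioc_self ht, param_of_mem_Ioo ht⟩,
      isPreconnected_param_image Ioc_subset_Icc_self isPreconnected_Ioc⟩
    · rintro _ ⟨s, hs, rfl⟩
      rcases hs.2.eq_or_lt with rfl | hsL
      · rwa [param_length]
      · exact hstar s ⟨hs.1, hsL⟩
    · rw [param_length, show Γ.tgt e = v from htgt]

lemma vertexStar_inter_nonempty_of_adj {u v : V} (h : Γ.graph.Adj u v) :
    (Γ.vertexStar {u} ∩ Γ.vertexStar {v}).Nonempty := by
  let e : Γ.Edge := ⟨s(u, v), h⟩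
  have hmid : Γ.length e / 2 ∈ Ioo 0 (Γ.length e) :=
    ⟨half_pos (Γ.length_pos e), half_lt_self (Γ.length_pos e)⟩
  refine ⟨_, param_mem_vertexStar ?_ hmid, param_mem_vertexStar ?_ hmid⟩
  · exact (src_tgt_eq_or_swap h).imp And.left And.right
  · exact (src_tgt_eq_or_swap h).symm.imp And.left And.right

lemma isConnected_vertexStar {C : Set V} (hC : (Γ.graph.induce C).Connected) :
    IsConnected (Γ.vertexStar C) := by
  have := hC.nonempty
  have hunion : Γ.vertexStar C = ⋃ v : C, Γ.vertexStar {(v : V)} := by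
    refine Subset.antisymm ?_ (iUnion_subset fun v => vertexStar_mono (singleton_subset_iff.2 v.2))
    rintro (v | ⟨e, t, ht⟩) hp
    · exact mem_iUnion.2 ⟨⟨v, hp⟩, rfl⟩
    · rcases hp with hsrc | htgt
      · exact mem_iUnion.2 ⟨⟨_, hsrc⟩, .inl rfl⟩
      · exact mem_iUnion.2 ⟨⟨_, htgt⟩, .inr rfl⟩
  rw [hunion]
  refine IsConnected.iUnion_of_reflTransGen
    (fun v => isConnected_vertexStar_singleton _) fun u v => ?_
  exact Relation.ReflTransGen.mono (fun _ _ h => vertexStar_inter_nonempty_of_adj h) _ _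
    ((SimpleGraph.reachable_iff_reflTransGen u v).1 (hC.preconnected u v))

lemma closure_vertexStar_subset (C : Set V) :
    closure (Γ.vertexStar C) ⊆
      Γ.vertexStar C ∪ Point.vertex '' {v | v ∉ C ∧ ∃ u ∈ C, Γ.graph.Adj u v} := by
  have hclosure : closure (Γ.vertexStar C) ⊆
      Point.vertex '' C ∪ edgeHull (Γ.incidentEdges C) := by
    refine closure_minimal ?_ ((isClosed_vertex_image C).union (isClosed_edgeHull _))
    rintro (v | ⟨e, t, ht⟩) hp
    · exact .inl ⟨v, hp, rfl⟩
    · exact .inr (inner_mem_edgeHull.2 hp)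
  rintro (v | ⟨e, t, ht⟩) hp
  · by_cases hv : v ∈ C
    · exact .inl hv
    obtain ⟨e, he, t, ht, hte⟩ := mem_edgeHull.1 ((hclosure hp).resolve_left (by simpa using hv))
    refine .inr ⟨v, ⟨hv, ?_⟩, rfl⟩
    rcases eq_endpoints_or_mem_Ioo_of_mem_Icc ht with rfl | rfl | ht'
    · obtain rfl : Γ.src e = v := by simpa using hte
      exact ⟨_, he.resolve_left hv, (adj_src_tgt e).symm⟩
    · obtain rfl : Γ.tgt e = v := by simpa using hte
      exact ⟨_, he.resolve_right hv, adj_src_tgt e⟩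
    · simp [param_of_mem_Ioo ht'] at hte
  · exact .inl (inner_mem_edgeHull.1 ((hclosure hp).resolve_left (by simp)))

lemma isCompact_frontier_vertexStar {C : Set V}
    (hC : {v | v ∉ C ∧ ∃ u ∈ C, Γ.graph.Adj u v}.Finite) :
    IsCompact (frontier (Γ.vertexStar C)) := by
  refine ((hC.image Point.vertex).subset fun p hp => ?_).isCompact
  exact (closure_vertexStar_subset C hp.1).resolve_left fun h => hp.2 <|
    (isOpen_vertexStar C).interior_eq.symm ▸ h

lemma exists_disjoint_of_iInter_eq_empty {C : ℕ → Set V} (hanti : Antitone C)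
    (hempty : ⋂ n, C n = ∅) {T : Set V} (hT : T.Finite) : ∃ n, Disjoint T (C n) := by
  have h : ∀ᶠ n in atTop, ∀ v ∈ T, v ∉ C n := by
    refine (eventually_all_finite hT).2 fun v _ => ?_
    obtain ⟨m, hm⟩ : ∃ m, v ∉ C m := by
      simpa using (hempty ▸ notMem_empty v : v ∉ ⋂ n, C n)
    filter_upwards [eventually_ge_atTop m] with n hn hv using hm (hanti hn hv)
  exact h.exists.imp fun n hn => disjoint_left.2 hn

lemma iInter_closure_vertexStar {C : ℕ → Set V} (hanti : Antitone C) (hempty : ⋂ n, C n = ∅) :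
    ⋂ n, closure (Γ.vertexStar (C n)) = ∅ := by
  refine eq_empty_of_forall_notMem fun p hp => ?_
  replace hp := fun n => closure_vertexStar_subset (C n) (mem_iInter.1 hp n)
  rcases p with v | ⟨e, t, ht⟩
  · obtain ⟨n, hn⟩ := exists_disjoint_of_iInter_eq_empty hanti hempty
      ((Γ.finite_neighborSet v).insert v)
    rcases hp n with hv | ⟨_, ⟨-, u, hu, huv⟩, ⟨⟩⟩
    · exact disjoint_left.1 hn (mem_insert v _) hv
    · exact disjoint_left.1 hn (mem_insert_of_mem v huv.symm) hu
  · obtain ⟨n, hn⟩ := exists_disjoint_of_iInter_eq_empty hanti hempty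
      (toFinite {Γ.src e, Γ.tgt e})
    rcases (hp n).resolve_right (by simp) with h | h
    · exact disjoint_left.1 hn (.inl rfl) h
    · exact disjoint_left.1 hn (.inr rfl) h

/-- The open stars of a decreasing sequence of connected sets of vertices, as a sequence that
represents a topological end. -/
def endSeqOfVertexSets (Γ : MetricGraph V) (C : ℕ → Set V) (hanti : Antitone C)
    (hempty : ⋂ n, C n = ∅) (hconn : ∀ n, (Γ.graph.induce (C n)).Connected)
    (hbdry : ∀ n, {v | v ∉ C n ∧ ∃ u ∈ C n, Γ.graph.Adj u v}.Finite) : Γ.EndSeq where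
  set n := Γ.vertexStar (C n)
  isOpen n := isOpen_vertexStar (C n)
  isConnected n := isConnected_vertexStar (hconn n)
  isCompact_frontier n := isCompact_frontier_vertexStar (hbdry n)
  subset n := vertexStar_mono (hanti n.le_succ)
  iInter_closure := iInter_closure_vertexStar hanti hempty

lemma EndSeq.not_subset_of_isCompact (U : Γ.EndSeq) (n : ℕ) {K : Set Γ.Point} (hK : IsCompact K)
    (hK' : IsClosed K) : ¬ U.set n ⊆ K := by
  intro hUK
  have hanti : Antitone U.set := antitone_nat_of_succ_le U.subset
  obtain ⟨p, hp⟩ := IsCompact.nonempty_iInter_of_sequence_nonempty_isCompact_isClosed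
    (fun k => closure (U.set (n + k))) (fun k => closure_mono (hanti (by omega)))
    (fun k => (U.isConnected (n + k)).nonempty.closure)
    (hK.of_isClosed_subset isClosed_closure (closure_minimal hUK hK')) fun k => isClosed_closure
  have hp' : p ∈ ⋂ k, closure (U.set k) := mem_iInter.2 fun k =>
    closure_mono (hanti (by omega)) (mem_iInter.1 hp k)
  rwa [U.iInter_closure] at hp'

lemma EndSeq.infinite_vertices (U : Γ.EndSeq) (n : ℕ) :
    {v : V | .vertex v ∈ U.set n}.Infinite := by
  intro hfin
  set T := {v : V | .vertex v ∈ U.set n}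
  have hF := (finite_edgesMeeting_of_isCompact (U.isCompact_frontier n)).union
    (finite_incidentEdges (Γ := Γ) hfin)
  refine U.not_subset_of_isCompact n ((hfin.image Point.vertex).isCompact.union
    (isCompact_edgeHull hF)) ((isClosed_vertex_image T).union (isClosed_edgeHull _)) ?_
  rintro (v | ⟨e, t, ht⟩) hp
  · exact .inl ⟨v, hp, rfl⟩
  refine .inr (inner_mem_edgeHull.2 (or_iff_not_imp_left.2 fun he => .inl ?_))
  rw [← param_of_mem_Ioo] at hp
  rcases forall_mem_or_forall_notMem (U.isOpen n) he with h | h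
  · have hsrc := h 0 (zero_mem_Icc e)
    rwa [param_zero] at hsrc
  · exact (h t (Ioo_subset_Icc_self ht) hp).elim

end

/-! ### Sobolev functions on the metric graph -/

section

variable {V : Type*} {Γ : MetricGraph V} {f g : Γ.Point → ℂ}

/-- The contribution of the edge `e` to the squared `H¹` norm of `f`. -/
def sobolevSqOn (f : Γ.Point → ℂ) (e : Γ.Edge) : ℝ≥0∞ := sobolevSq (Γ.length e) (Γ.onEdge f e)

lemma l2NormSq_add_energy (f : Γ.Point → ℂ) : Γ.l2NormSq f + Γ.energy f =
    ∑' e, sobolevSqOn f e := by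
  rw [l2NormSq, energy, ← ENNReal.tsum_add]
  exact tsum_congr fun e => (sobolevSq_eq_add _ _).symm

lemma mem_H1_iff : f ∈ Γ.H1 ↔ Continuous f ∧
    (∀ e, IntervalH1 (Γ.length e) (Γ.onEdge f e)) ∧ ∑' e, sobolevSqOn f e < ∞ := by
  rw [← l2NormSq_add_energy, ENNReal.add_lt_top, H1, mem_ofPred_eq]
  tauto

lemma mem_H10_iff : f ∈ Γ.H10 ↔ f ∈ Γ.H1 ∧
    ∀ ε : ℝ≥0∞, 0 < ε → ∃ g ∈ Γ.domPreminimal, ∑' e, sobolevSqOn (f - g) e ≤ ε := by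
  have hnorm (g : Γ.Point → ℂ) (ε : ℝ≥0∞) : Γ.h1Norm g < ε ↔ ∑' e, sobolevSqOn g e < ε ^ 2 := by
    rw [h1Norm, l2NormSq_add_energy, one_div, ENNReal.rpow_inv_lt_iff two_pos,
      ← ENNReal.rpow_ofNat]
  simp only [H10, hnorm, mem_ofPred_eq]
  refine and_congr_right fun _ => ⟨fun h ε hε => ?_, fun h ε hε => ?_⟩
  · obtain ⟨g, hg, hfg⟩ := h (ε ^ (2⁻¹ : ℝ)) (by positivity)
    rw [← ENNReal.rpow_ofNat, ENNReal.rpow_inv_rpow two_ne_zero] at hfg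
    exact ⟨g, hg, hfg.le⟩
  · obtain ⟨η, hη, hηε⟩ := exists_between (ENNReal.pow_pos hε 2)
    obtain ⟨g, hg, hfg⟩ := h η hη
    exact ⟨g, hg, hfg.trans_lt hηε⟩

lemma tsum_sobolevSqOn_add_le
    (hf : ∀ e, AbsolutelyContinuousOnInterval (Γ.onEdge f e) 0 (Γ.length e))
    (hg : ∀ e, AbsolutelyContinuousOnInterval (Γ.onEdge g e) 0 (Γ.length e)) :
    ∑' e, sobolevSqOn (f + g) e ≤ 2 * (∑' e, sobolevSqOn f e + ∑' e, sobolevSqOn g e) := by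
  rw [← ENNReal.tsum_add, ← ENNReal.tsum_mul_left]
  exact ENNReal.tsum_le_tsum fun e => sobolevSq_add_le (hf e) (hg e)

lemma enorm_sq_vertex_le_add_sobolevSqOn_of_adj
    (hf : ∀ e, AbsolutelyContinuousOnInterval (Γ.onEdge f e) 0 (Γ.length e)) {u v : V}
    (h : Γ.graph.Adj u v) :
    ‖f (.vertex u)‖ₑ ^ 2 ≤ ‖f (.vertex v)‖ₑ ^ 2 + sobolevSqOn f ⟨s(u, v), h⟩ := by
  set e : Γ.Edge := ⟨s(u, v), h⟩
  have hst := enorm_sq_le_add_sobolevSq (hf e) (zero_mem_Icc e) (length_mem_Icc e)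
  have hts := enorm_sq_le_add_sobolevSq (hf e) (length_mem_Icc e) (zero_mem_Icc e)
  simp only [onEdge, param_zero, param_length] at hst hts
  rcases src_tgt_eq_or_swap h with ⟨hu, hv⟩ | ⟨hv, hu⟩
  · rwa [hu, hv] at hst
  · rwa [hu, hv] at hts

/-- Multiplied by the length of a fixed edge `e₀`, the value at `v` is compared with the mean of
`‖f‖²` over `e₀` along a path from `v` to `e₀`. -/
lemma length_mul_enorm_sq_vertex_le
    (hf : ∀ e, AbsolutelyContinuousOnInterval (Γ.onEdge f e) 0 (Γ.length e)) (e₀ : Γ.Edge)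
    (v : V) :
    ENNReal.ofReal (Γ.length e₀) * ‖f (.vertex v)‖ₑ ^ 2 ≤
      (1 + 2 * ENNReal.ofReal (Γ.length e₀)) * ∑' e, sobolevSqOn f e := by
  set ℓ := ENNReal.ofReal (Γ.length e₀)
  set N := ∑' e, sobolevSqOn f e
  have hpath : ‖f (.vertex v)‖ₑ ^ 2 ≤ ‖f (.vertex (Γ.src e₀))‖ₑ ^ 2 + N :=
    le_add_tsum_of_reachable (a := fun v => ‖f (.vertex v)‖ₑ ^ 2)
      (enorm_sq_vertex_le_add_sobolevSqOn_of_adj hf) (Γ.connected.preconnected v _)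
  have hle_tsum : sobolevSqOn f e₀ ≤ N := ENNReal.le_tsum e₀
  have hedge : ∀ t ∈ Ioo 0 (Γ.length e₀), ‖f (.vertex v)‖ₑ ^ 2 ≤
      (‖Γ.onEdge f e₀ t‖ₑ ^ 2 + ‖deriv (Γ.onEdge f e₀) t‖ₑ ^ 2) + 2 * N := by
    intro t ht
    have h := enorm_sq_le_add_sobolevSq (hf e₀) (zero_mem_Icc e₀) (Ioo_subset_Icc_self ht)
    rw [onEdge, param_zero] at h
    calc ‖f (.vertex v)‖ₑ ^ 2 ≤ ‖Γ.onEdge f e₀ t‖ₑ ^ 2 + N + N :=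
          hpath.trans (by gcongr; exact h.trans (by gcongr; exact hle_tsum))
      _ = ‖Γ.onEdge f e₀ t‖ₑ ^ 2 + 2 * N := by ring
      _ ≤ _ := by gcongr; exact le_self_add
  calc ℓ * ‖f (.vertex v)‖ₑ ^ 2
      = ∫⁻ _ in Ioo 0 (Γ.length e₀), ‖f (.vertex v)‖ₑ ^ 2 := by
        rw [setLIntegral_const, Real.volume_Ioo, sub_zero, mul_comm]
    _ ≤ ∫⁻ t in Ioo 0 (Γ.length e₀),
          ((‖Γ.onEdge f e₀ t‖ₑ ^ 2 + ‖deriv (Γ.onEdge f e₀) t‖ₑ ^ 2) + 2 * N) :=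
        setLIntegral_mono' measurableSet_Ioo hedge
    _ = sobolevSqOn f e₀ + 2 * N * ℓ := by
        rw [lintegral_add_right _ measurable_const, setLIntegral_const, Real.volume_Ioo, sub_zero]
        rfl
    _ ≤ N + 2 * N * ℓ := by gcongr
    _ = (1 + 2 * ℓ) * N := by ring

/-- The function on the metric graph with given values at the vertices and in the interiors of the
edges. -/
def glue (a : V → ℂ) (G : Γ.Edge → ℝ → ℂ) : Γ.Point → ℂ
  | .vertex v => a v
  | .inner e t _ => G e t

lemma onEdge_glue {a : V → ℂ} {G : Γ.Edge → ℝ → ℂ} {e : Γ.Edge} (h0 : G e 0 = a (Γ.src e))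
    (hL : G e (Γ.length e) = a (Γ.tgt e)) :
    EqOn (Γ.onEdge (glue a G) e) (G e) (Icc 0 (Γ.length e)) := by
  intro t ht
  rw [onEdge]
  rcases eq_endpoints_or_mem_Ioo_of_mem_Icc ht with rfl | rfl | ht'
  · rw [param_zero, h0, glue]
  · rw [param_length, hL, glue]
  · rw [param_of_mem_Ioo ht', glue]

end

/-! ### Ends of finite volume -/

lemma tsum_lt_top_of_le_of_notMem {ι : Type*} {w u : ι → ℝ≥0∞} {s : Set ι} (hs : s.Finite)
    (hw : ∀ i, w i < ∞) (hwu : ∀ i ∉ s, w i ≤ u i) (hu : ∑' i, u i < ∞) : ∑' i, w i < ∞ := by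
  obtain ⟨F, rfl⟩ := hs.exists_finset_coe
  rw [← ENNReal.sum_add_tsum_compl F]
  refine ENNReal.add_lt_top.2 ⟨ENNReal.sum_lt_top.2 fun i _ => hw i, lt_of_le_of_lt ?_ hu⟩
  calc ∑' i : ((F : Set ι)ᶜ : Set ι), w i
    _ ≤ ∑' i : ((F : Set ι)ᶜ : Set ι), u i := ENNReal.tsum_le_tsum fun i => hwu i i.2
    _ ≤ ∑' i, u i := ENNReal.tsum_comp_le_tsum_of_injective Subtype.val_injective _

section

variable {V : Type*} {Γ : MetricGraph V}

/-- The continuous function with given values at the vertices that is affine on each edge. -/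
def affineExtension (a : V → ℂ) : Γ.Point → ℂ :=
  glue a fun e t => a (Γ.src e) + (t / Γ.length e) • (a (Γ.tgt e) - a (Γ.src e))

lemma onEdge_affineExtension (a : V → ℂ) (e : Γ.Edge) :
    EqOn (Γ.onEdge (affineExtension a) e)
      (fun t => a (Γ.src e) + (t / Γ.length e) • (a (Γ.tgt e) - a (Γ.src e)))
      (Icc 0 (Γ.length e)) :=
  onEdge_glue (by simp) (by simp [(Γ.length_pos e).ne'])

lemma intervalH1_affineExtension (a : V → ℂ) (e : Γ.Edge) :
    IntervalH1 (Γ.length e) (Γ.onEdge (affineExtension a) e) :=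
  (intervalH1_of_contDiff (by fun_prop)).congr (Γ.length_pos e).le
    (onEdge_affineExtension a e).symm

lemma continuous_affineExtension (a : V → ℂ) : Continuous (affineExtension a : Γ.Point → ℂ) :=
  continuous_iff.2 fun e =>
    (intervalH1_affineExtension a e).1.continuousOn.mono Icc_subset_uIcc

lemma sobolevSqOn_affineExtension_of_eq {a : V → ℂ} {e : Γ.Edge} (h : a (Γ.src e) = a (Γ.tgt e)) :
    sobolevSqOn (affineExtension a) e = ‖a (Γ.src e)‖ₑ ^ 2 * ENNReal.ofReal (Γ.length e) := by
  have hconst : EqOn (Γ.onEdge (affineExtension a) e) (fun _ => a (Γ.src e))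
      (Icc 0 (Γ.length e)) := by
    simpa only [h, sub_self, smul_zero, add_zero] using onEdge_affineExtension a e
  rw [sobolevSqOn, sobolevSq_congr hconst, sobolevSq]
  simp

lemma sobolevSqOn_affineExtension_indicator_le {A : Set Γ.Point} (hA : IsOpen A) {e : Γ.Edge}
    (he : e ∉ edgesMeeting (frontier A)) :
    sobolevSqOn (affineExtension ((Point.vertex ⁻¹' A).indicator 1)) e ≤
      volume {t : ℝ | t ∈ Icc 0 (Γ.length e) ∧ Γ.param e t ∈ A} := by
  rcases forall_mem_or_forall_notMem hA he with h | h <;>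
    have h0 := h 0 (zero_mem_Icc e) <;> have hL := h _ (length_mem_Icc e) <;>
    rw [param_zero] at h0 <;> rw [param_length] at hL
  · have hset : {t : ℝ | t ∈ Icc 0 (Γ.length e) ∧ Γ.param e t ∈ A} = Icc 0 (Γ.length e) :=
      Set.ext fun t => and_iff_left_of_imp (h t)
    rw [hset, sobolevSqOn_affineExtension_of_eq] <;> simp [h0, hL]
  · rw [sobolevSqOn_affineExtension_of_eq] <;> simp [h0, hL]

lemma affineExtension_indicator_mem_H1 {A : Set Γ.Point} (hA : IsOpen A)
    (hfr : IsCompact (frontier A)) (hvol : Γ.vol A < ∞) :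
    affineExtension ((Point.vertex ⁻¹' A).indicator 1) ∈ Γ.H1 := by
  have hH1 := intervalH1_affineExtension (Γ := Γ) ((Point.vertex ⁻¹' A).indicator 1)
  exact mem_H1_iff.2 ⟨continuous_affineExtension _, hH1, tsum_lt_top_of_le_of_notMem
    (finite_edgesMeeting_of_isCompact hfr) (fun e => (hH1 e).sobolevSq_lt_top)
    (fun _ => sobolevSqOn_affineExtension_indicator_le hA) hvol⟩

lemma finite_vertices_of_finite_edgesMeeting [Nontrivial V] {A : Set Γ.Point}
    (hA : (edgesMeeting A).Finite) : {v : V | .vertex v ∈ A}.Finite := by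
  refine (hA.biUnion fun e _ => toFinite {Γ.src e, Γ.tgt e}).subset fun v hv => ?_
  obtain ⟨u, huv⟩ := Γ.connected.preconnected.exists_adj_of_nontrivial v
  let e : Γ.Edge := ⟨s(v, u), huv⟩
  rcases src_tgt_eq_or_swap huv with ⟨h, -⟩ | ⟨-, h⟩
  · exact mem_iUnion₂.2 ⟨e, ⟨0, zero_mem_Icc e, by rwa [param_zero, h]⟩, .inl h.symm⟩
  · exact mem_iUnion₂.2 ⟨e, ⟨_, length_mem_Icc e, by rwa [param_length, h]⟩, .inr h.symm⟩

lemma notMem_H10_of_infinite_vertices {f : Γ.Point → ℂ}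
    (hf : {v : V | f (.vertex v) = 1}.Infinite) : f ∉ Γ.H10 := by
  have : Nontrivial V := Set.nontrivial_of_nontrivial hf.nontrivial
  intro hf0
  obtain ⟨hfH1, happrox⟩ := mem_H10_iff.1 hf0
  obtain ⟨u, hu⟩ := Γ.connected.preconnected.exists_adj_of_nontrivial (Classical.arbitrary V)
  let e₀ : Γ.Edge := ⟨s(_, u), hu⟩
  set ℓ := ENNReal.ofReal (Γ.length e₀)
  have hℓ : ℓ ≠ 0 := by simpa [ℓ] using Γ.length_pos e₀
  obtain ⟨ε, hε, hεℓ⟩ : ∃ ε, 0 < ε ∧ ε < ℓ / (1 + 2 * ℓ) :=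
    exists_between (ENNReal.div_pos hℓ (by finiteness))
  obtain ⟨g, ⟨hgH2, hgfin, -, -⟩, hfg⟩ := happrox ε hε
  have hgvertex : {v : V | g (.vertex v) ≠ 0}.Finite :=
    finite_vertices_of_finite_edgesMeeting (A := {p | g p ≠ 0}) hgfin
  obtain ⟨v, hv, hgv⟩ := (hf.sdiff hgvertex).nonempty
  have hv1 : (f - g) (.vertex v) = 1 := by
    rw [Pi.sub_apply, not_not.1 hgv, sub_zero]
    exact hv
  have hbound := length_mul_enorm_sq_vertex_le (f := f - g)
    (fun e => ((mem_H1_iff.1 hfH1).2.1 e).1.sub (hgH2 e).1.1) e₀ v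
  rw [hv1, enorm_one, one_pow, mul_one] at hbound
  refine (hbound.trans_lt ?_).false
  calc (1 + 2 * ℓ) * ∑' e, sobolevSqOn (f - g) e ≤ (1 + 2 * ℓ) * ε := by gcongr
    _ = ε * (1 + 2 * ℓ) := mul_comm _ _
    _ < ℓ := ENNReal.mul_lt_of_lt_div hεℓ

lemma hasInfiniteVolume_of_H1_eq_H10 (h : Γ.H1 = Γ.H10) (γ : Γ.TopEnd) :
    γ.HasInfiniteVolume := by
  rintro ⟨U, -, n, hn⟩
  have hmem := affineExtension_indicator_mem_H1 (U.isOpen n) (U.isCompact_frontier n) hn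
  refine notMem_H10_of_infinite_vertices ((U.infinite_vertices n).mono fun v hv => ?_) (h ▸ hmem)
  exact indicator_of_mem (s := Point.vertex ⁻¹' U.set n) hv 1

end

/-! ### Vanishing at infinity -/

section

variable {V : Type*} {Γ : MetricGraph V} {f : Γ.Point → ℂ}

lemma mul_vol_le_tsum_sobolevSqOn
    (hf : ∀ e, AbsolutelyContinuousOnInterval (Γ.onEdge f e) 0 (Γ.length e)) {c : ℝ≥0∞}
    {A : Set Γ.Point} (hc : ∀ p ∈ A, c ≤ ‖f p‖ₑ ^ 2) : c * Γ.vol A ≤ ∑' e, sobolevSqOn f e := by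
  rw [vol, ← ENNReal.tsum_mul_left]
  refine ENNReal.tsum_le_tsum fun e => ?_
  have hIcc : {t : ℝ | t ∈ Icc 0 (Γ.length e) ∧ Γ.param e t ∈ A} ⊆ Icc 0 (Γ.length e) :=
    fun t ht => ht.1
  rw [← Measure.restrict_eq_self volume hIcc, ← Measure.restrict_congr_set Ioo_ae_eq_Icc]
  refine le_trans ?_ (mul_meas_ge_le_lintegral₀ (aemeasurable_sobolevSq (hf e)) c)
  gcongr with t
  exact fun ht => (hc _ ht.2).trans le_self_add

lemma enorm_sq_vertex_le_add_tsum_incidentEdges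
    (hf : ∀ e, AbsolutelyContinuousOnInterval (Γ.onEdge f e) 0 (Γ.length e)) {C : Set V}
    (hC : (Γ.graph.induce C).Connected) {u v : V} (hu : u ∈ C) (hv : v ∈ C) :
    ‖f (.vertex u)‖ₑ ^ 2 ≤ ‖f (.vertex v)‖ₑ ^ 2 + ∑' e : Γ.incidentEdges C, sobolevSqOn f e := by
  let ι : (Γ.graph.induce C).edgeSet ↪ Γ.Edge := (SimpleGraph.Embedding.induce C).mapEdgeSet
  have hι (e) : ι e ∈ Γ.incidentEdges C := by
    obtain ⟨⟨x, y⟩, h⟩ := e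
    rcases src_tgt_eq_or_swap (Γ := Γ) (u := x) (v := y) h with ⟨hx, -⟩ | ⟨-, hx⟩
    · exact .inl (hx ▸ x.2)
    · exact .inr (hx ▸ x.2)
  calc ‖f (.vertex u)‖ₑ ^ 2
    _ ≤ ‖f (.vertex v)‖ₑ ^ 2 + ∑' e, sobolevSqOn f (ι e) :=
      le_add_tsum_of_reachable (a := fun x : C => ‖f (.vertex x)‖ₑ ^ 2)
        (w := fun e => sobolevSqOn f (ι e))
        (fun h => enorm_sq_vertex_le_add_sobolevSqOn_of_adj hf h)
        (hC.preconnected ⟨u, hu⟩ ⟨v, hv⟩)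
    _ ≤ ‖f (.vertex v)‖ₑ ^ 2 + ∑' e : Γ.incidentEdges C, sobolevSqOn f e := by
      gcongr
      exact ENNReal.tsum_comp_le_tsum_of_injective
        (f := fun e => (⟨ι e, hι e⟩ : Γ.incidentEdges C))
        (fun e e' h => ι.injective (congrArg Subtype.val h)) fun e => sobolevSqOn f e

lemma enorm_sq_vertex_le_add_tsum_of_mem_vertexStar
    (hf : ∀ e, AbsolutelyContinuousOnInterval (Γ.onEdge f e) 0 (Γ.length e)) {C : Set V}
    (hC : (Γ.graph.induce C).Connected) {v : V} (hv : v ∈ C) {p : Γ.Point}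
    (hp : p ∈ Γ.vertexStar C) :
    ‖f (.vertex v)‖ₑ ^ 2 ≤ ‖f p‖ₑ ^ 2 + 2 * ∑' e : Γ.incidentEdges C, sobolevSqOn f e := by
  suffices ∃ u ∈ C, ‖f (.vertex u)‖ₑ ^ 2 ≤ ‖f p‖ₑ ^ 2 + ∑' e : Γ.incidentEdges C, sobolevSqOn f e by
    obtain ⟨u, hu, hup⟩ := this
    rw [two_mul, ← add_assoc]
    exact (enorm_sq_vertex_le_add_tsum_incidentEdges hf hC hv hu).trans (by gcongr)
  rcases p with u | ⟨e, t, ht⟩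
  · exact ⟨u, hp, le_self_add⟩
  have hle_tsum : sobolevSqOn f e ≤ ∑' e : Γ.incidentEdges C, sobolevSqOn f e :=
    ENNReal.le_tsum (f := fun e : Γ.incidentEdges C => sobolevSqOn f e) ⟨e, hp⟩
  have hedge {s : ℝ} (hs : s ∈ Icc 0 (Γ.length e)) : ‖f (Γ.param e s)‖ₑ ^ 2 ≤
      ‖f (.inner e t ht)‖ₑ ^ 2 + ∑' e : Γ.incidentEdges C, sobolevSqOn f e := by
    rw [← param_of_mem_Ioo ht]
    exact (enorm_sq_le_add_sobolevSq (hf e) hs (Ioo_subset_Icc_self ht)).trans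
      (add_le_add_right hle_tsum _)
  rcases hp with hsrc | htgt
  · exact ⟨_, hsrc, param_zero e ▸ hedge (zero_mem_Icc e)⟩
  · exact ⟨_, htgt, param_length e ▸ hedge (length_mem_Icc e)⟩

lemma exists_tsum_incidentEdges_lt {w : Γ.Edge → ℝ≥0∞} (hw : ∑' e, w e ≠ ∞) {C : ℕ → Set V}
    (hanti : Antitone C) (hempty : ⋂ n, C n = ∅) {ε : ℝ≥0∞} (hε : 0 < ε) :
    ∃ n, ∑' e : Γ.incidentEdges (C n), w e < ε := by
  obtain ⟨F, hF⟩ := ((ENNReal.tendsto_tsum_compl_atTop_zero hw).eventually_lt_const hε).exists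
  obtain ⟨n, hn⟩ := exists_disjoint_of_iInter_eq_empty hanti hempty
    (F.finite_toSet.biUnion fun e _ => toFinite {Γ.src e, Γ.tgt e})
  refine ⟨n, (ENNReal.tsum_mono_subtype w (subset_compl_comm.1 fun e heF he => ?_)).trans_lt hF⟩
  rcases he with he | he
  · exact disjoint_left.1 hn (mem_iUnion₂.2 ⟨e, heF, .inl rfl⟩) he
  · exact disjoint_left.1 hn (mem_iUnion₂.2 ⟨e, heF, .inr rfl⟩) he

lemma finite_setOf_le_enorm_sq_vertex (hends : ∀ γ : Γ.TopEnd, γ.HasInfiniteVolume)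
    (hf : f ∈ Γ.H1) {c : ℝ≥0∞} (hc : 0 < c) : {v : V | c ≤ ‖f (.vertex v)‖ₑ ^ 2}.Finite := by
  by_contra hS
  obtain ⟨-, hH1, hfin⟩ := mem_H1_iff.1 hf
  obtain ⟨C, hanti, hempty, hC⟩ :=
    exists_antitone_connected_of_infinite Γ.connected Γ.finite_neighborSet hS
  have hc2 : 0 < c / 2 := ENNReal.half_pos hc.ne'
  obtain ⟨n, hn⟩ := exists_tsum_incidentEdges_lt hfin.ne hanti hempty (ENNReal.half_pos hc2.ne')
  obtain ⟨v, hvS, hvC⟩ := (hC n).2.2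
  have hlow (p) (hp : p ∈ Γ.vertexStar (C n)) : c / 2 ≤ ‖f p‖ₑ ^ 2 := by
    by_contra! hlt
    have hvp := enorm_sq_vertex_le_add_tsum_of_mem_vertexStar (fun e => (hH1 e).1) (hC n).1 hvC hp
    refine ((hvS.trans hvp).trans_lt (ENNReal.add_lt_add hlt (ENNReal.mul_lt_of_lt_div' hn))).ne ?_
    exact (ENNReal.add_halves c).symm
  refine hends (Quotient.mk _ (Γ.endSeqOfVertexSets C hanti hempty (fun n => (hC n).1)
    fun n => (hC n).2.1)) ⟨_, rfl, n, ?_⟩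
  exact ENNReal.lt_top_of_mul_ne_top_right
    ((mul_vol_le_tsum_sobolevSqOn (fun e => (hH1 e).1) hlow).trans_lt hfin).ne hc2.ne'

lemma finite_edgesMeeting_le_enorm_sq (hends : ∀ γ : Γ.TopEnd, γ.HasInfiniteVolume)
    (hf : f ∈ Γ.H1) {c : ℝ≥0∞} (hc : 0 < c) : (edgesMeeting {p | c ≤ ‖f p‖ₑ ^ 2}).Finite := by
  obtain ⟨-, hH1, hfin⟩ := mem_H1_iff.1 hf
  have hc2 : 0 < c / 2 := ENNReal.half_pos hc.ne'
  refine ((finite_incidentEdges (finite_setOf_le_enorm_sq_vertex hends hf hc2)).union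
    (ENNReal.finite_const_le_of_tsum_ne_top hfin.ne hc2.ne')).subset fun e ⟨t, ht, hle⟩ => ?_
  by_contra he
  have hsrc : ‖f (.vertex (Γ.src e))‖ₑ ^ 2 < c / 2 := not_le.1 fun h => he (.inl (.inl h))
  have hle_tsum : sobolevSqOn f e < c / 2 := not_le.1 fun h => he (.inr h)
  have hosc := enorm_sq_le_add_sobolevSq (hH1 e).1 ht (zero_mem_Icc e)
  rw [onEdge, onEdge, param_zero] at hosc
  refine (hle.trans_lt (hosc.trans_lt (ENNReal.add_lt_add hsrc hle_tsum))).ne ?_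
  exact (ENNReal.add_halves c).symm

end

/-! ### Approximation by functions in the domain of the pre-minimal Laplacian -/

section

variable {V : Type*} {Γ : MetricGraph V} {f : Γ.Point → ℂ}

lemma tendsto_tsum_sobolevSqOn_clip (hf : f ∈ Γ.H1) :
    Tendsto (fun r => ∑' e, sobolevSqOn (clip r ∘ f) e) (𝓝[>] 0) (𝓝 0) := by
  obtain ⟨-, hH1, hfin⟩ := mem_H1_iff.1 hf
  let _ : MeasurableSpace Γ.Edge := ⊤
  simp only [← lintegral_count]
  rw [← lintegral_zero (μ := (Measure.count : Measure Γ.Edge))]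
  refine tendsto_lintegral_filter_of_dominated_convergence (fun e => 2 ^ 2 * sobolevSqOn f e)
    (.of_forall fun r => measurable_from_top) ?_ ?_
    (.of_forall fun e => tendsto_sobolevSq_clip_comp (hH1 e).1 (hH1 e).sobolevSq_lt_top.ne)
  · filter_upwards [self_mem_nhdsWithin] with r hr
    refine .of_forall fun e => ?_
    have := sobolevSq_lipschitz_comp_le (lipschitzWith_clip hr) (clip_zero r) (hH1 e).1
    exact_mod_cast this
  · rw [lintegral_count, ENNReal.tsum_mul_left]
    exact ENNReal.mul_ne_top (by norm_num) hfin.ne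

lemma outwardDeriv_eq_zero {e : Γ.Edge} {G : ℝ → ℂ}
    (hfG : EqOn (Γ.onEdge f e) G (Icc 0 (Γ.length e))) (hG : Differentiable ℝ G)
    (h0 : deriv G 0 = 0) (hL : deriv G (Γ.length e) = 0) (v : V) : Γ.outwardDeriv f e v = 0 := by
  have hderiv {t : ℝ} (ht : t ∈ Icc 0 (Γ.length e)) :
      derivWithin (Γ.onEdge f e) (Icc 0 (Γ.length e)) t = deriv G t := by
    rw [derivWithin_congr hfG (hfG ht),
      (hG t).derivWithin (uniqueDiffOn_Icc (Γ.length_pos e) t ht)]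
  rw [outwardDeriv, hderiv (zero_mem_Icc e), hderiv (length_mem_Icc e), h0, hL, neg_zero, ite_self]

lemma glue_mem_domPreminimal {a : V → ℂ} {G : Γ.Edge → ℝ → ℂ} (hG : ∀ e, ContDiff ℝ 2 (G e))
    (h0 : ∀ e, G e 0 = a (Γ.src e)) (hL : ∀ e, G e (Γ.length e) = a (Γ.tgt e))
    (hd0 : ∀ e, deriv (G e) 0 = 0) (hdL : ∀ e, deriv (G e) (Γ.length e) = 0)
    (hfin : {e | G e ≠ 0}.Finite) : glue a G ∈ Γ.domPreminimal := by
  have hglue (e) : EqOn (Γ.onEdge (glue a G) e) (G e) (Icc 0 (Γ.length e)) :=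
    onEdge_glue (h0 e) (hL e)
  refine ⟨fun e => (intervalH2_of_contDiff (hG e)).congr (Γ.length_pos e).le (hglue e).symm,
    hfin.subset fun e ⟨t, ht, hne⟩ hGe => hne ?_,
    continuous_iff.2 fun e => (hG e).continuous.continuousOn.congr (hglue e),
    fun v => Finset.sum_eq_zero fun e _ =>
      outwardDeriv_eq_zero (hglue e) ((hG e).differentiable two_ne_zero) (hd0 e) (hdL e) v⟩
  rw [hglue e ht, hGe, Pi.zero_apply]

lemma exists_contDiff_approx_onEdge {e : Γ.Edge} (hf : IntervalH1 (Γ.length e) (Γ.onEdge f e))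
    {δ : ℝ≥0∞} (hδ : δ ≠ 0) :
    ∃ G : ℝ → ℂ, ContDiff ℝ 2 G ∧ G 0 = f (.vertex (Γ.src e)) ∧
      G (Γ.length e) = f (.vertex (Γ.tgt e)) ∧ deriv G 0 = 0 ∧ deriv G (Γ.length e) = 0 ∧
      (e ∉ edgesMeeting {p | f p ≠ 0} → G = 0) ∧ sobolevSq (Γ.length e) (Γ.onEdge f e - G) ≤
        (edgesMeeting {p | f p ≠ 0}).indicator (fun _ => δ) e := by
  have hsrc : Γ.onEdge f e 0 = f (.vertex (Γ.src e)) := by rw [onEdge, param_zero]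
  have htgt : Γ.onEdge f e (Γ.length e) = f (.vertex (Γ.tgt e)) := by rw [onEdge, param_length]
  rw [← hsrc, ← htgt]
  by_cases he : e ∈ edgesMeeting {p | f p ≠ 0}
  · obtain ⟨G, hG, h0, hL, hd0, hdL, hle⟩ := hf.exists_contDiff_approx (Γ.length_pos e) hδ
    exact ⟨G, hG, h0, hL, hd0, hdL, fun h => (h he).elim, by rwa [indicator_of_mem he]⟩
  · have hzero : EqOn (Γ.onEdge f e) 0 (Icc 0 (Γ.length e)) := fun t ht =>
      not_not.1 fun hne => he ⟨t, ht, hne⟩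
    refine ⟨0, contDiff_const, (hzero (zero_mem_Icc e)).symm, (hzero (length_mem_Icc e)).symm,
      by simp, by simp, fun _ => rfl, ?_⟩
    rw [sub_zero, sobolevSq_congr hzero, sobolevSq]
    simp

lemma exists_mem_domPreminimal_tsum_sobolevSqOn_sub_le
    (hf : ∀ e, IntervalH1 (Γ.length e) (Γ.onEdge f e))
    (hfin : (edgesMeeting {p | f p ≠ 0}).Finite) {δ : ℝ≥0∞} (hδ : δ ≠ 0) :
    ∃ g ∈ Γ.domPreminimal, ∑' e, sobolevSqOn (f - g) e ≤ δ := by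
  obtain ⟨F, hF⟩ := hfin.exists_finset_coe
  have hη : δ / F.card ≠ 0 := (ENNReal.div_pos hδ (ENNReal.natCast_ne_top _)).ne'
  choose G hG h0 hL hd0 hdL hG0 hle using fun e => exists_contDiff_approx_onEdge (hf e) hη
  let g : Γ.Point → ℂ := glue (fun v => f (.vertex v)) G
  have hg : g ∈ Γ.domPreminimal := glue_mem_domPreminimal hG h0 hL hd0 hdL
    (hfin.subset fun e he => not_imp_comm.1 (hG0 e) he)
  refine ⟨g, hg, ?_⟩
  calc ∑' e, sobolevSqOn (f - g) e
    _ ≤ ∑' e, (F : Set Γ.Edge).indicator (fun _ => δ / F.card) e :=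
      ENNReal.tsum_le_tsum fun e => (sobolevSq_congr fun t ht =>
        congrArg (Γ.onEdge f e t - ·) (onEdge_glue (h0 e) (hL e) ht)).trans_le (hF ▸ hle e)
    _ = F.card * (δ / F.card) := by
      rw [← sum_eq_tsum_indicator, Finset.sum_const, nsmul_eq_mul]
    _ ≤ δ := ENNReal.mul_div_le

lemma H1_eq_H10_of_forall_hasInfiniteVolume (hends : ∀ γ : Γ.TopEnd, γ.HasInfiniteVolume) :
    Γ.H1 = Γ.H10 := by
  refine Subset.antisymm (fun f hf => mem_H10_iff.2 ⟨hf, fun ε hε => ?_⟩) fun f hf => hf.1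
  obtain ⟨-, hH1, -⟩ := mem_H1_iff.1 hf
  have hε4 : 0 < ε / 4 := ENNReal.div_pos hε.ne' ENNReal.ofNat_ne_top
  obtain ⟨r, hclip, hr⟩ := (((tendsto_tsum_sobolevSqOn_clip hf).eventually_lt_const hε4).and
    self_mem_nhdsWithin).exists
  have hclipH1 (e) : IntervalH1 (Γ.length e) (Γ.onEdge (clip r ∘ f) e) :=
    (hH1 e).lipschitz_comp (lipschitzWith_clip hr)
  have hsubH1 (e) : IntervalH1 (Γ.length e) (Γ.onEdge (f - clip r ∘ f) e) :=
    (hH1 e).sub (hclipH1 e)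
  have hsupp : (edgesMeeting {p | (f - clip r ∘ f) p ≠ 0}).Finite := by
    refine (finite_edgesMeeting_le_enorm_sq hends hf (c := ENNReal.ofReal r ^ 2)
      (ENNReal.pow_pos (ENNReal.ofReal_pos.2 hr) 2)).subset fun e ⟨t, ht, hne⟩ => ⟨t, ht, ?_⟩
    exact ofReal_sq_le_enorm_sq_of_clip_ne hr fun h => hne (sub_eq_zero.2 h.symm)
  obtain ⟨g, hg, hgδ⟩ := exists_mem_domPreminimal_tsum_sobolevSqOn_sub_le hsubH1 hsupp hε4.ne'
  refine ⟨g, hg, ?_⟩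
  calc ∑' e, sobolevSqOn (f - g) e = ∑' e, sobolevSqOn (clip r ∘ f + (f - clip r ∘ f - g)) e := by
        rw [add_sub_assoc', add_sub_cancel]
    _ ≤ 2 * (∑' e, sobolevSqOn (clip r ∘ f) e + ∑' e, sobolevSqOn (f - clip r ∘ f - g) e) :=
      tsum_sobolevSqOn_add_le (fun e => (hclipH1 e).1) fun e => ((hsubH1 e).sub (hg.1 e).1).1
    _ ≤ 2 * (ε / 4 + ε / 4) := by gcongr
    _ = 4 * (ε / 4) := by ring
    _ ≤ ε := ENNReal.mul_div_le

end

end MetricGraph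

end

theorem corollary3p10 {V : Type*} [Countable V] [Infinite V] (Γ : MetricGraph V) :
    Γ.H1 = Γ.H10 ↔ ∀ γ : Γ.TopEnd, γ.HasInfiniteVolume :=
  ⟨MetricGraph.hasInfiniteVolume_of_H1_eq_H10, MetricGraph.H1_eq_H10_of_forall_hasInfiniteVolume⟩
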